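/- **Setting.** Let $k\ge 1$, $C_i,\kappa_i>0$ $(1\le i\le k)$, $\epsilon>0$, $\sigma>0$. Let $\mathbf b=(1/C_1,0,\dots,0)^\top\in\mathbb R^k$ and let $\mathbf A$ be the tridiagonal $k\times k$ matrix of the $k$-box energy balance model: with $\lambda_i=\kappa_{i+1}$ for $1\le i\le k-2$, $\lambda_{k-1}=\epsilon\kappa_k$, $\lambda_k=0$, $$A_{ii}=-\frac{\kappa_i+\lambda_i}{C_i},\qquad A_{i,i+1}=\frac{\lambda_i}{C_i},\qquad A_{i,i-1}=\frac{\kappa_i}{C_i}.$$ Let $\mathbf A=\boldsymbol\Phi\,\mathrm{Diag}(-1/d_1,\dots,-1/d_k)\,\boldsymbol\Phi^{-1}$ be a diagonalisation and define $q_i$ by $\boldsymbol\Phi^{-1}\mathbf b=(q_1/d_1,\dots,q_k/d_k)^\top$. Let $\mathsf F\sim\mathrm{GP}(F,K)$ be a jointly measurable Gaussian process on $[0,\infty)$ with $F$ and $s\mapsto\sqrt{K(s,s)}$ integrable on bounded intervals, let $\mathsf B$ be a standard one-dimensional Brownian motion independent of $\mathsf F$, and let $\mathsf X$ be the solution, with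 continuous paths, of $$\mathrm d\mathsf X(t)=\mathbf A\mathsf X(t)\,\mathrm dt+\mathbf b\,\mathsf F(t)\,\mathrm dt+\sigma\mathbf b\,\mathrm d\mathsf B(t),\qquad \mathsf X(0)=0.$$ Put $(\mathsf S_1,\dots,\mathsf S_k)^\top=\boldsymbol\Phi^{-1}\mathsf X$ and $\mathsf T=\sum_{i=1}^k\mathsf S_i$ (this is the temperature $\mathsf X_1$ of the uppermost box if the first row of $\boldsymbol\Phi$ is $(1,\dots,1)$). Define $$m_i(t)=\frac{q_i}{d_i}\int_0^tF(s)e^{-(t-s)/d_i}\,\mathrm ds,\qquad k_{ij}(t,t')=\frac{q_iq_j}{d_id_j}\int_0^t\!\int_0^{t'}K(s,s')e^{-(t-s)/d_i}e^{-(t'-s')/d_j}\,\mathrm ds'\,\mathrm ds,$$ $m_{\mathsf T}=\sum_im_i$, $k_{\mathsf T}=\sum_{i,j}k_{ij}$, and $$\gamma_{ij}(t,t')=\frac{q_iq_j}{d_i+d_j}\exp\!\left(\frac{-|t-t'|}{d_j\mathbf 1_{\{t\le t'\}}+d_i\mathbf 1_{\{t>t'\}}}\right),\qquad \gamma_i(t,t')=\frac{q_i^2}{2d_i}e^{-|t-t'|/d_i},\qquad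 \nu_i=\sum_{j=1}^k\frac{2d_iq_j}{q_i(d_i+d_j)}.$$ *Long time regime.* A family $(Y_i(t))_{i,\,t\ge0}$ is said to be $\mathrm{GP}(m,c)$ in the long time regime if it is jointly Gaussian with mean function $m$; $\mathrm{Cov}(Y_i(t),Y_j(t'))-c_{ij}(t,t')\to0$ as soon as $t\to\infty$ or $t'\to\infty$; $c$ is a positive semidefinite kernel; and for all $n$ and $i_1,\dots,i_n$ the Lévy–Prokhorov distance between the law of $(Y_{i_1}(t_1),\dots,Y_{i_n}(t_n))$ and the Gaussian law with mean $(m_{i_a}(t_a))_a$ and covariance matrix $(c_{i_ai_b}(t_a,t_b))_{a,b}$ tends to $0$ when $t_1,\dots,t_n$ all tend to $\infty$. **Claim.** One has $d_i>0$ and $q_i\neq0$ for all $i$, so that all expressions are meaningful, and: 1. Almost surely, $\mathrm d\mathsf S_i(t)=\frac1{d_i}\big(q_i\mathsf F(t)-\mathsf S_i(t)\big)\mathrm dt+\sigma\frac{q_i}{d_i}\,\mathrm d\mathsf B(t)$ with $\mathsf S_i(0)=0$, for all $i$. 2. Almost surely, for all $i$ and $t$, $\mathsf S_i(t)=\mathsf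 S_i^\circ(t)+\sigma\eta_i(t)$, where $\mathsf S_i^\circ(t)=\frac{q_i}{d_i}\int_0^t\mathsf F(s)e^{-(t-s)/d_i}\,\mathrm ds$ and $\eta_i(t)=\frac{q_i}{d_i}\int_0^te^{-(t-s)/d_i}\,\mathrm d\mathsf B(s)$ (Wiener integral). The family $(\mathsf S_i^\circ)_i$ is jointly Gaussian with means $m_i$ and cross-covariances $k_{ij}$, and the processes $(\mathsf S^\circ_i)_i$ and $(\eta_i)_i$ are independent. 3. The family $(\eta_i)_i$ is jointly Gaussian with mean zero and $$\mathrm{Cov}(\eta_i(t),\eta_j(t'))=\frac{q_iq_j}{d_i+d_j}\,e^{-(d_jt+d_it')/(d_id_j)}\Big(e^{\frac{d_i+d_j}{d_id_j}\min(t,t')}-1\Big)=\frac{q_iq_j}{d_i+d_j}\begin{cases}e^{-|t-t'|/d_j}-e^{-(d_jt+d_it')/(d_id_j)}&\text{if }t\le t',\\ e^{-|t-t'|/d_i}-e^{-(d_jt+d_it')/(d_id_j)}&\text{if }t\ge t'.\end{cases}$$ 4. $\mathrm{Cov}(\eta_i(t),\eta_j(t'))\sim\gamma_{ij}(t,t')$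 (the ratio tends to $1$) when $t$ and $t'$ both tend to $\infty$; $\gamma_{ii}=\gamma_i$; and $(\eta_i)_i$ is $\mathrm{GP}(0,(\gamma_{ij}))$ in the long time regime. 5. $(\mathsf S_i)_i$ is jointly Gaussian with means $m_i$ and cross-covariances $k_{ij}+\sigma^2\,\mathrm{Cov}(\eta_i(\cdot),\eta_j(\cdot))$, and it is $\mathrm{GP}\big((m_i),(k_{ij}+\sigma^2\gamma_{ij})\big)$ in the long time regime; in particular $\mathsf S_i$ is $\mathrm{GP}(m_i,k_{ii}+\sigma^2\gamma_i)$ in the long time regime. 6. $\mathsf T$ is a Gaussian process with mean $m_{\mathsf T}$ and covariance $k_{\mathsf T}(t,t')+\sigma^2\sum_{i,j}\mathrm{Cov}(\eta_i(t),\eta_j(t'))$; one has $\sum_{i,j}\gamma_{ij}=\sum_{i}\nu_i\gamma_i$; and $\mathsf T$ is $\mathrm{GP}\big(m_{\mathsf T},\,k_{\mathsf T}+\sigma^2\sum_{i=1}^k\nu_i\gamma_i\big)$ in the long time regime. -/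

import Mathlib

open MeasureTheory ProbabilityTheory Filter Topology
open scoped NNReal ENNReal Matrix

noncomputable section

namespace BoxModel

/-! ### Gaussian processes -/

/-- `X ∼ GP(m, c)`: all finite-dimensional laws are Gaussian, the mean function is `m` and the
covariance function is `c`. The index type is arbitrary; with `Fin k × ℝ≥0` one gets a joint
(multi-output) Gaussian process. -/
structure IsGP {Ω τ : Type*} [MeasurableSpace Ω] (P : Measure Ω) (X : τ → Ω → ℝ)
    (m : τ → ℝ) (c : τ → τ → ℝ) : Prop where
  gaussian : IsGaussianProcess X P
  mean : ∀ a, ∫ ω, X a ω ∂P = m a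
  cov : ∀ a b, cov[X a, X b; P] = c a b

/-- `X ∼ GP(m, c)` in the long time regime, for a family `X i t`, `i : ι`:
`X` is a Gaussian process with mean function exactly `m`; the error made by replacing
its covariance function by `c` tends to `0` as soon as one of the two times tends to infinity;
`c` is a positive semidefinite kernel; and the Lévy-Prokhorov distance between the law of
`(X i₁ t₁, …, X iₙ tₙ)` and the Gaussian law with mean `m` and covariance `c` tends to `0`
when `t₁, …, tₙ` all tend to infinity (in whatever way). -/
structure IsLongTimeGP {Ω ι : Type*} [MeasurableSpace Ω] (P : Measure Ω) (X : ι → ℝ≥0 → Ω → ℝ)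
    (m : ι → ℝ≥0 → ℝ) (c : ι → ι → ℝ≥0 → ℝ≥0 → ℝ) : Prop where
  gaussian : IsGaussianProcess (fun (p : ι × ℝ≥0) ↦ X p.1 p.2) P
  mean : ∀ i t, ∫ ω, X i t ω ∂P = m i t
  cov : ∀ i j, Tendsto (fun p : ℝ≥0 × ℝ≥0 ↦ cov[X i p.1, X j p.2; P] - c i j p.1 p.2)
    (Filter.coprod atTop atTop) (𝓝 0)
  posSemidef : ∀ (n : ℕ) (i : Fin n → ι) (t : Fin n → ℝ≥0),
    (Matrix.of fun a b ↦ c (i a) (i b) (t a) (t b)).PosSemidef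
  law : ∀ (n : ℕ) (i : Fin n → ι),
    Tendsto (fun t : Fin n → ℝ≥0 ↦
        levyProkhorovEDist
          (P.map fun ω ↦ (WithLp.toLp 2 fun a ↦ X (i a) (t a) ω : EuclideanSpace ℝ (Fin n)))
          (multivariateGaussian (WithLp.toLp 2 fun a ↦ m (i a) (t a))
            (Matrix.of fun a b ↦ c (i a) (i b) (t a) (t b))))
      atTop (𝓝 0)

/-! ### The Wiener integral of a deterministic function -/

/-- A step function `∑_{l < n} val l · 1_{(pt l, pt (l + 1)]}` on the half line. -/
structure Step where
  n : ℕ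
  pt : ℕ → ℝ≥0
  mono : Monotone pt
  val : ℕ → ℝ

/-- The step function as a function on `ℝ`. -/
def Step.eval (φ : Step) (s : ℝ) : ℝ :=
  ∑ l ∈ Finset.range φ.n,
    (Set.Ioc (φ.pt l : ℝ) (φ.pt (l + 1) : ℝ)).indicator (fun _ ↦ φ.val l) s

/-- The elementary stochastic integral `∑_{l < n} val l · (B (pt (l + 1)) - B (pt l))`. -/
def Step.integral {Ω : Type*} (φ : Step) (B : ℝ≥0 → Ω → ℝ) (ω : Ω) : ℝ :=
  ∑ l ∈ Finset.range φ.n, φ.val l * (B (φ.pt (l + 1)) ω - B (φ.pt l) ω)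

/-- `I = ∫_0^t f(s) dB(s)` for a deterministic `f`: `I` is the limit in `L²(P)` of the elementary
integrals of step functions on `(0, t]` that converge to `f` in `L²(0, t)`. (By the Itô isometry
this determines `I` up to almost sure equality when `B` is a Brownian motion.) -/
def IsWienerIntegral {Ω : Type*} [MeasurableSpace Ω] (P : Measure Ω) (B : ℝ≥0 → Ω → ℝ)
    (f : ℝ → ℝ) (t : ℝ≥0) (I : Ω → ℝ) : Prop :=
  MemLp I 2 P ∧ ∃ φ : ℕ → Step,
    (∀ N, (φ N).pt (φ N).n ≤ t) ∧
    Tendsto (fun N ↦ eLpNorm (fun s ↦ (φ N).eval s - f s) 2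
      (volume.restrict (Set.Ioc 0 (t : ℝ)))) atTop (𝓝 0) ∧
    Tendsto (fun N ↦ eLpNorm (fun ω ↦ (φ N).integral B ω - I ω) 2 P) atTop (𝓝 0)

/-! ### The `k`-box energy balance model -/

/-- Coefficient of the heat exchange of box `i` with the box below it: the transfer coefficient of
the next box, multiplied by the efficacy `ε` if the next box is the last one; there is
no such exchange for the last box. -/
def below {k : ℕ} (κ : Fin k → ℝ) (ε : ℝ) (i : Fin k) : ℝ :=
  if h : i.val + 1 < k then (if i.val + 2 = k then ε else 1) * κ ⟨i.val + 1, h⟩ else 0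

/-- The tridiagonal temperature feedback matrix `A`. -/
def feedback {k : ℕ} (C κ : Fin k → ℝ) (ε : ℝ) : Matrix (Fin k) (Fin k) ℝ :=
  Matrix.of fun i j ↦
    if j = i then -(κ i + below κ ε i) / C i
    else if j.val = i.val + 1 then below κ ε i / C i
    else if i.val = j.val + 1 then κ i / C i
    else 0

/-- The forcing feedback vector `b = (1 / C₁, 0, …, 0)`. -/
def forcingVec {k : ℕ} (C : Fin k → ℝ) (i : Fin k) : ℝ :=
  if i.val = 0 then 1 / C i else 0

/-- `X` solves `dX = A X dt + b F dt + σ b dB`, `X(0) = 0`: almost surely, `X` has continuous paths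
and satisfies the integrated equation at all times (the noise is additive). -/
structure IsSolution {Ω : Type*} [MeasurableSpace Ω] (P : Measure Ω) {k : ℕ}
    (A : Matrix (Fin k) (Fin k) ℝ) (b : Fin k → ℝ) (σ : ℝ) (F B : ℝ≥0 → Ω → ℝ)
    (X : ℝ≥0 → Ω → Fin k → ℝ) : Prop where
  continuous : ∀ᵐ ω ∂P, Continuous fun t ↦ X t ω
  eq : ∀ᵐ ω ∂P, ∀ (t : ℝ≥0) (i : Fin k), X t ω i =
    (∫ s in (0 : ℝ)..t, ((A *ᵥ X s.toNNReal ω) i + b i * F s.toNNReal ω)) + σ * b i * B t ω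

/-- `A = Φ Diag(-1/d₁, …, -1/d_k) Φ⁻¹` and `Φ⁻¹ b = (q₁/d₁, …, q_k/d_k)`. -/
structure IsDiagonalisation {k : ℕ} (A : Matrix (Fin k) (Fin k) ℝ) (b : Fin k → ℝ)
    (Φ : Matrix (Fin k) (Fin k) ℝ) (d q : Fin k → ℝ) : Prop where
  isUnit : IsUnit Φ.det
  feedback_eq : A = Φ * Matrix.diagonal (fun i ↦ -1 / d i) * Φ⁻¹
  forcing_eq : ∀ i, (Φ⁻¹ *ᵥ b) i = q i / d i

/-- The thermal responses `S = Φ⁻¹ X`. -/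
def thermal {Ω : Type*} {k : ℕ} (Φ : Matrix (Fin k) (Fin k) ℝ) (X : ℝ≥0 → Ω → Fin k → ℝ)
    (i : Fin k) (t : ℝ≥0) (ω : Ω) : ℝ :=
  (Φ⁻¹ *ᵥ X t ω) i

/-- The temperature `T = ∑ᵢ Sᵢ`. -/
def temperature {Ω : Type*} {k : ℕ} (Φ : Matrix (Fin k) (Fin k) ℝ) (X : ℝ≥0 → Ω → Fin k → ℝ)
    (t : ℝ≥0) (ω : Ω) : ℝ :=
  ∑ i, thermal Φ X i t ω

variable {k : ℕ} (d q : Fin k → ℝ)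

/-- `(qᵢ / dᵢ) ∫_0^t f(s) e^{-(t-s)/dᵢ} ds`. -/
def response (f : ℝ≥0 → ℝ) (i : Fin k) (t : ℝ≥0) : ℝ :=
  q i / d i * ∫ s in (0 : ℝ)..t, f s.toNNReal * Real.exp (-((t : ℝ) - s) / d i)

/-- `k_ij(t, t')`, the cross-covariance of the thermal responses to the forcing. -/
def kCross (K : ℝ≥0 → ℝ≥0 → ℝ) (i j : Fin k) (t t' : ℝ≥0) : ℝ :=
  q i * q j / (d i * d j) * ∫ s in (0 : ℝ)..t, ∫ s' in (0 : ℝ)..t',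
    K s.toNNReal s'.toNNReal * Real.exp (-((t : ℝ) - s) / d i) *
      Real.exp (-((t' : ℝ) - s') / d j)

/-- The exact cross-covariance of the internal variabilities. -/
def etaCov (i j : Fin k) (t t' : ℝ≥0) : ℝ :=
  q i * q j / (d i + d j) * Real.exp (-(d j * t + d i * t') / (d i * d j)) *
    (Real.exp ((d i + d j) / (d i * d j) * min (t : ℝ) t') - 1)

/-- The long-time cross-covariance `γ_ij(t, t')` of the internal variabilities. -/
def gammaCross (i j : Fin k) (t t' : ℝ≥0) : ℝ :=
  q i * q j / (d i + d j) * Real.exp (-|(t : ℝ) - t'| / (if t ≤ t' then d j else d i))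

/-- The exponential (Matérn-1/2) kernel `γᵢ`. -/
def gamma (i : Fin k) (t t' : ℝ≥0) : ℝ :=
  q i ^ 2 / (2 * d i) * Real.exp (-|(t : ℝ) - t'| / d i)

/-- The weights `νᵢ`. -/
def nu (i : Fin k) : ℝ :=
  ∑ j, 2 * d i * q j / (q i * (d i + d j))

end BoxModel

end

/-! Multiplying the equation by `Φ⁻¹` decouples it: each thermal response solves a scalar linear
equation with rate `1 / d i`, driven by `q i / d i` times the forcing and the noise. The noise is
additive, so no stochastic calculus is needed. Once the Brownian term is subtracted, a path is
absolutely continuous, and variation of constants (`variation_of_constants`,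
`eq_expConv_add_ornstein`) gives `S = S° + σ η` path by path. There the Wiener integral appears in
the integrated-by-parts form `B(t) - (1/δ) ∫₀ᵗ B(s) e^{-(t-s)/δ} ds` (`ornstein`).
`isWienerIntegral_ornstein` identifies it with the `L²` limit of elementary integrals.

Everything then depends on time integrals of the jointly Gaussian family made of the forcing and the
Brownian motion. Such integrals lie in the closed `L²` span of that family
(`toLp_integral_process_mem_closedSpan`), and this span contains only Gaussian variables because
Gaussian laws are closed in `L²` (`isClosed_hasGaussianLaw`). Joint Gaussianity follows, means and
covariances come from Fubini and explicit integration, and independence of `S°` and `η` comes from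
vanishing cross-covariances.

For long times, `γ = Cov(η) + memory`, where `memory` has entries `M i j * e^{-t/d i} * e^{-t'/d j}`
with `M i j = q i * q j / (d i + d j)`. It is the covariance lost by starting at time `0` and not at
`-∞`. The matrix `M` is positive semidefinite, being the limit of the covariance matrices of `η(T)`.
Hence the approximating Gaussian law is the exact law convolved with a centred Gaussian law of
covariance `memory`, whose trace tends to `0`, and Chebyshev's inequality bounds the Lévy–Prokhorov
distance (`levyProkhorovEDist_multivariateGaussian_le`). The covariance of `S°` need not converge,
since it is the same in both laws.

Finally, `d i > 0` is a discrete maximum principle for the tridiagonal matrix, and `q i ≠ 0` holds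
because a left eigenvector that vanishes at the uppermost box vanishes everywhere. -/

namespace BoxModel

set_option linter.unusedSectionVars false

/-! ### Gaussian variables form a closed subset of `L²` -/

section GaussianClosure

variable {Ω : Type*} [MeasurableSpace Ω] {P : Measure Ω} [IsProbabilityMeasure P]

lemma integral_norm_le_norm_Lp_two (f : Lp ℝ 2 P) : ∫ ω, ‖f ω‖ ∂P ≤ ‖f‖ := by
  have h := eLpNorm_le_eLpNorm_of_exponent_le (p := 1) (q := 2) (by norm_num)
    (Lp.aestronglyMeasurable f) (μ := P)
  rw [Lp.norm_def, integral_norm_eq_lintegral_enorm (Lp.aestronglyMeasurable f),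
    ← eLpNorm_one_eq_lintegral_enorm]
  exact ENNReal.toReal_mono (Lp.eLpNorm_ne_top f) h

lemma norm_exp_mul_I_sub_le (x y : ℝ) :
    ‖Complex.exp (x * Complex.I) - Complex.exp (y * Complex.I)‖ ≤ |x - y| := by
  have h : Complex.exp (x * Complex.I) - Complex.exp (y * Complex.I) =
      Complex.exp (y * Complex.I) * (Complex.exp (Complex.I * ((x - y : ℝ) : ℂ)) - 1) := by
    rw [mul_sub, ← Complex.exp_add]; push_cast; ring_nf
  rw [h, norm_mul, Complex.norm_exp_ofReal_mul_I, one_mul]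
  exact (Real.norm_exp_I_mul_ofReal_sub_one_le).trans_eq (Real.norm_eq_abs _)

lemma continuous_integral_Lp_two : Continuous fun f : Lp ℝ 2 P ↦ ∫ ω, f ω ∂P := by
  refine LipschitzWith.continuous (K := 1) (LipschitzWith.of_dist_le_mul fun f g ↦ ?_)
  have hf : ∀ f : Lp ℝ 2 P, Integrable f P := fun f ↦ (Lp.memLp f).integrable (by norm_num)
  rw [dist_eq_norm, dist_eq_norm, ← integral_sub (hf f) (hf g), NNReal.coe_one, one_mul]
  refine (norm_integral_le_integral_norm _).trans
    (le_trans (le_of_eq ?_) (integral_norm_le_norm_Lp_two (f - g)))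
  refine integral_congr_ae ?_
  filter_upwards [Lp.coeFn_sub f g] with ω h
  rw [h]
  rfl

lemma continuous_charFun_Lp_two (t : ℝ) :
    Continuous fun f : Lp ℝ 2 P ↦ charFun (P.map f) t := by
  have hm : ∀ f : Lp ℝ 2 P, AEMeasurable f P := fun f ↦ (Lp.aestronglyMeasurable f).aemeasurable
  have h0 : ∀ f : Lp ℝ 2 P, charFun (P.map f) t =
      ∫ ω, Complex.exp (((t * f ω : ℝ) : ℂ) * Complex.I) ∂P := fun f ↦ by
    rw [charFun_apply_real, integral_map (hm f) (by fun_prop)]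
    simp
  have hint : ∀ f : Lp ℝ 2 P,
      Integrable (fun ω ↦ Complex.exp (((t * f ω : ℝ) : ℂ) * Complex.I)) P := fun f ↦ by
    refine Integrable.of_bound (C := 1) ?_ (ae_of_all _ fun ω ↦ ?_)
    · exact (Complex.continuous_exp.measurable.comp_aemeasurable
        ((Complex.measurable_ofReal.comp_aemeasurable ((hm f).const_mul t)).mul_const
          _)).aestronglyMeasurable
    · rw [Complex.norm_exp_ofReal_mul_I]
  simp_rw [h0]
  refine LipschitzWith.continuous (K := ‖t‖₊) (LipschitzWith.of_dist_le_mul fun f g ↦ ?_)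
  rw [dist_eq_norm, dist_eq_norm, ← integral_sub (hint f) (hint g)]
  refine (norm_integral_le_integral_norm _).trans ?_
  have hfg : Integrable (fun ω ↦ |t| * ‖(f - g : Lp ℝ 2 P) ω‖) P :=
    (((Lp.memLp (f - g)).integrable (by norm_num)).norm).const_mul _
  refine (integral_mono_ae ((hint f).sub (hint g)).norm hfg ?_).trans ?_
  · filter_upwards [Lp.coeFn_sub f g] with ω h
    refine (norm_exp_mul_I_sub_le _ _).trans ?_
    rw [h, ← mul_sub, abs_mul]
    rfl
  · rw [integral_const_mul]
    exact mul_le_mul_of_nonneg_left (integral_norm_le_norm_Lp_two _) (abs_nonneg t)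

lemma integral_sq_Lp_two (f : Lp ℝ 2 P) : ∫ ω, (f ω) ^ 2 ∂P = ‖f‖ ^ 2 := by
  rw [← real_inner_self_eq_norm_sq, L2.inner_def]
  simp [pow_two]

lemma continuous_variance_Lp_two : Continuous fun f : Lp ℝ 2 P ↦ Var[f; P] := by
  have h : ∀ f : Lp ℝ 2 P, Var[f; P] = ‖f‖ ^ 2 - (∫ ω, f ω ∂P) ^ 2 := fun f ↦ by
    rw [variance_eq_sub (Lp.memLp f), ← integral_sq_Lp_two]
    rfl
  simp_rw [h]
  have := continuous_integral_Lp_two (P := P)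
  fun_prop

/-- For each `t` the Gaussian formula for the characteristic function is an equation between
continuous functions of `f` in `L²`: the characteristic function is Lipschitz with constant `|t|`,
and mean and variance are continuous. -/
lemma isClosed_hasGaussianLaw : IsClosed {f : Lp ℝ 2 P | HasGaussianLaw f P} := by
  have h : {f : Lp ℝ 2 P | HasGaussianLaw f P} = ⋂ t : ℝ, {f : Lp ℝ 2 P |
      charFun (P.map f) t = Complex.exp (((t * ∫ ω, f ω ∂P : ℝ) : ℂ) * Complex.I -
        ((t ^ 2 * Var[f; P] : ℝ) : ℂ) / 2)} := by
    ext f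
    simp only [Set.mem_ofPred_eq, Set.mem_iInter]
    rw [hasGaussianLaw_iff_charFun_map_eq (Lp.aestronglyMeasurable f).aemeasurable]
    refine forall_congr' fun t ↦ ?_
    have h1 : (fun ω ↦ inner ℝ t (f ω)) = fun ω ↦ t * f ω := by
      ext ω; simp [mul_comm]
    rw [h1, integral_const_mul, variance_const_mul]
  rw [h]
  refine isClosed_iInter fun t ↦ isClosed_eq (continuous_charFun_Lp_two t) ?_
  have h1 := continuous_integral_Lp_two (P := P)
  have h2 := continuous_variance_Lp_two (P := P)
  fun_prop

lemma coeFn_sum_Lp_two {ι : Type*} (s : Finset ι) (f : ι → Lp ℝ 2 P) :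
    ⇑(∑ i ∈ s, f i) =ᵐ[P] ∑ i ∈ s, ⇑(f i) := by
  classical
  induction s using Finset.induction_on with
  | empty => simpa using Lp.coeFn_zero ℝ 2 P
  | insert i s hi ih =>
    rw [Finset.sum_insert hi, Finset.sum_insert hi]
    exact (Lp.coeFn_add _ _).trans ((ae_eq_refl _).add ih)

/-- The closed subspace of `L²` spanned by a family of square integrable random variables. -/
noncomputable def closedSpan {T : Type*} (X : T → Ω → ℝ) (P : Measure Ω)
    (hX : ∀ t, MemLp (X t) 2 P) : Submodule ℝ (Lp ℝ 2 P) :=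
  (Submodule.span ℝ (Set.range fun t ↦ (hX t).toLp (X t))).topologicalClosure

lemma toLp_mem_closedSpan {T : Type*} {X : T → Ω → ℝ} (hX : ∀ t, MemLp (X t) 2 P) (t : T) :
    (hX t).toLp (X t) ∈ closedSpan X P hX :=
  Submodule.le_topologicalClosure _ (Submodule.subset_span ⟨t, rfl⟩)

lemma hasGaussianLaw_of_mem_closedSpan {T : Type*} {X : T → Ω → ℝ} (hG : IsGaussianProcess X P)
    (hX : ∀ t, MemLp (X t) 2 P) {f : Lp ℝ 2 P} (hf : f ∈ closedSpan X P hX) :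
    HasGaussianLaw f P := by
  refine closure_minimal (fun g hg ↦ ?_) isClosed_hasGaussianLaw hf
  obtain ⟨c, rfl⟩ := (Finsupp.mem_span_range_iff_exists_finsupp).1 hg
  have hlaw := (hG.hasGaussianLaw c.support).map
    (∑ i : c.support, c i • ContinuousLinearMap.proj (R := ℝ) (φ := fun _ : c.support ↦ ℝ) i)
  refine hlaw.congr ?_
  have h1 := coeFn_sum_Lp_two c.support fun t ↦ c t • (hX t).toLp (X t)
  have h2 : ∀ᵐ ω ∂P, ∀ t ∈ c.support, (c t • (hX t).toLp (X t) : Lp ℝ 2 P) ω = c t * X t ω := by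
    rw [Filter.eventually_all_finset]
    intro t _
    filter_upwards [Lp.coeFn_smul (c t) ((hX t).toLp (X t)), (hX t).coeFn_toLp] with ω h h'
    rw [h, Pi.smul_apply, h', smul_eq_mul]
  rw [Finsupp.sum]
  filter_upwards [h1, h2] with ω h1 h2
  rw [h1, Finset.sum_apply, Finset.sum_congr rfl h2]
  simpa using Finset.sum_coe_sort c.support fun t ↦ c t * X t ω

lemma isGaussianProcess_of_mem_closedSpan {S T : Type*} {X : T → Ω → ℝ} {Y : S → Ω → ℝ}
    (hG : IsGaussianProcess X P) (hX : ∀ t, MemLp (X t) 2 P) (hY : ∀ s, MemLp (Y s) 2 P)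
    (h : ∀ s, (hY s).toLp (Y s) ∈ closedSpan X P hX) : IsGaussianProcess Y P where
  hasGaussianLaw I := by
    classical
    have hm : AEMeasurable (fun ω ↦ I.restrict (Y · ω)) P :=
      aemeasurable_pi_lambda _ fun s ↦ (hY s).aestronglyMeasurable.aemeasurable
    refine ⟨⟨fun L ↦ ?_⟩⟩
    have hL : HasGaussianLaw (fun ω ↦ L (I.restrict (Y · ω))) P := by
      let f : Lp ℝ 2 P := ∑ s : I, L (Pi.single s 1) • (hY s).toLp (Y s)
      have hf : f ∈ closedSpan X P hX :=
        Submodule.sum_mem _ fun s _ ↦ Submodule.smul_mem _ _ (h s)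
      refine (hasGaussianLaw_of_mem_closedSpan hG hX hf).congr ?_
      have h1 := coeFn_sum_Lp_two (Finset.univ : Finset I)
        fun s ↦ L (Pi.single s 1) • (hY s).toLp (Y s)
      have h2 : ∀ᵐ ω ∂P, ∀ s : I, (L (Pi.single s 1) • (hY s).toLp (Y s) : Lp ℝ 2 P) ω =
          L (Pi.single s 1) * Y s ω := by
        rw [ae_all_iff]
        intro s
        filter_upwards [Lp.coeFn_smul (L (Pi.single s 1)) ((hY s).toLp (Y s)),
          (hY s).coeFn_toLp] with ω h h'
        rw [h, Pi.smul_apply, h', smul_eq_mul]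
      filter_upwards [h1, h2] with ω h1 h2
      rw [h1, Finset.sum_apply, Finset.sum_congr rfl fun s _ ↦ h2 s]
      -- Expanding the vector in the standard basis shows that `L` of it is the linear combination
      -- `f`, with coefficients `L (Pi.single s 1)`.
      conv_rhs => rw [← Finset.univ_sum_single (I.restrict (Y · ω)), map_sum]
      refine Finset.sum_congr rfl fun s _ ↦ ?_
      have : (Pi.single s (I.restrict (Y · ω) s) : I → ℝ) =
          (Y s ω) • (Pi.single s 1 : I → ℝ) := by
        rw [← Pi.single_smul, smul_eq_mul, mul_one]; rfl
      rw [this, map_smul, smul_eq_mul, mul_comm]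
    have hLm : AEMeasurable L (P.map fun ω ↦ I.restrict (Y · ω)) := by fun_prop
    rw [AEMeasurable.map_map_of_aemeasurable hLm hm, integral_map hm (by fun_prop),
      variance_map hLm hm]
    exact hL.map_eq_gaussianReal

/-- Two independent Gaussian processes are jointly Gaussian. -/
lemma isGaussianProcess_sumElim {S T : Type*} {X : S → Ω → ℝ} {Y : T → Ω → ℝ}
    (hX : IsGaussianProcess X P) (hY : IsGaussianProcess Y P)
    (h : IndepFun (fun ω s ↦ X s ω) (fun ω t ↦ Y t ω) P) :
    IsGaussianProcess (Sum.elim X Y) P where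
  hasGaussianLaw I := by
    classical
    have hi : IndepFun (fun ω ↦ I.toLeft.restrict (X · ω)) (fun ω ↦ I.toRight.restrict (Y · ω)) P :=
      h.comp (φ := I.toLeft.restrict) (ψ := I.toRight.restrict)
        (Finset.measurable_restrict _) (Finset.measurable_restrict _)
    have hj := hi.hasGaussianLaw (hX.hasGaussianLaw I.toLeft) (hY.hasGaussianLaw I.toRight)
    let L : (I.toLeft → ℝ) × (I.toRight → ℝ) →L[ℝ] (I → ℝ) :=
      ContinuousLinearMap.pi fun i : I ↦ match i with
        | ⟨Sum.inl s, hs⟩ => (ContinuousLinearMap.proj ⟨s, Finset.mem_toLeft.2 hs⟩).comp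
            (ContinuousLinearMap.fst ℝ _ _)
        | ⟨Sum.inr t, ht⟩ => (ContinuousLinearMap.proj ⟨t, Finset.mem_toRight.2 ht⟩).comp
            (ContinuousLinearMap.snd ℝ _ _)
    refine (hj.map L).congr (ae_of_all _ fun ω ↦ ?_)
    ext ⟨i | i, hi⟩ <;> rfl

end GaussianClosure

/-! ### Time integrals of square integrable processes -/

section ProcessIntegral

variable {Ω : Type*} [MeasurableSpace Ω] {P : Measure Ω} [IsProbabilityMeasure P]
  {μ : Measure ℝ} [SFinite μ] {Y : ℝ → Ω → ℝ} {V : Ω → ℝ}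

lemma lintegral_enorm_mul_enorm_le {f g : Ω → ℝ} (hf : AEStronglyMeasurable f P)
    (hg : AEStronglyMeasurable g P) :
    ∫⁻ ω, ‖f ω‖ₑ * ‖g ω‖ₑ ∂P ≤ eLpNorm f 2 P * eLpNorm g 2 P := by
  have h := ENNReal.lintegral_mul_le_Lp_mul_Lq P Real.HolderConjugate.two_two hf.enorm hg.enorm
  rw [eLpNorm_eq_lintegral_rpow_enorm_toReal (by norm_num) (by norm_num),
    eLpNorm_eq_lintegral_rpow_enorm_toReal (by norm_num) (by norm_num)]
  simpa using h

/-- Cauchy–Schwarz in `ω` bounds the inner integral by `‖Y s‖₂ ‖V‖₂`. This justifies every use of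
Fubini below; `V = 1` gives means and path integrability, a general `V` gives covariances and inner
products. -/
lemma integrable_prod_process (hm : Measurable (Function.uncurry Y))
    (hi : ∫⁻ s, eLpNorm (Y s) 2 P ∂μ ≠ ∞) (hV : MemLp V 2 P) :
    Integrable (fun p : ℝ × Ω ↦ Y p.1 p.2 * V p.2) (μ.prod P) := by
  have hY : ∀ s, AEStronglyMeasurable (Y s) P := fun s ↦
    (hm.comp measurable_prodMk_left).aestronglyMeasurable
  have hVm : AEStronglyMeasurable (fun p : ℝ × Ω ↦ V p.2) (μ.prod P) :=
    hV.aestronglyMeasurable.comp_snd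
  have hmeas : AEStronglyMeasurable (fun p : ℝ × Ω ↦ Y p.1 p.2 * V p.2) (μ.prod P) :=
    hm.aestronglyMeasurable.mul hVm
  refine ⟨hmeas, ?_⟩
  rw [hasFiniteIntegral_iff_enorm, lintegral_prod _ hmeas.enorm]
  calc ∫⁻ s, ∫⁻ ω, ‖Y s ω * V ω‖ₑ ∂P ∂μ
      ≤ ∫⁻ s, eLpNorm (Y s) 2 P * eLpNorm V 2 P ∂μ := lintegral_mono fun s ↦ by
        simp_rw [enorm_mul]
        exact lintegral_enorm_mul_enorm_le (hY s) hV.aestronglyMeasurable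
    _ = (∫⁻ s, eLpNorm (Y s) 2 P ∂μ) * eLpNorm V 2 P :=
        lintegral_mul_const' _ _ hV.eLpNorm_ne_top
    _ < ∞ := ENNReal.mul_lt_top hi.lt_top hV.eLpNorm_lt_top

lemma ae_integrable_process (hm : Measurable (Function.uncurry Y))
    (hi : ∫⁻ s, eLpNorm (Y s) 2 P ∂μ ≠ ∞) : ∀ᵐ ω ∂P, Integrable (fun s ↦ Y s ω) μ := by
  have h := (integrable_prod_process hm hi (memLp_const (1 : ℝ))).prod_left_ae
  simpa using h

/-- Minkowski's integral inequality in `L²`. -/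
lemma eLpNorm_integral_process_le (hm : Measurable (Function.uncurry Y))
    (hi : ∫⁻ s, eLpNorm (Y s) 2 P ∂μ ≠ ∞) :
    eLpNorm (fun ω ↦ ∫ s, Y s ω ∂μ) 2 P ≤ ∫⁻ s, eLpNorm (Y s) 2 P ∂μ := by
  have hY : ∀ s, AEStronglyMeasurable (Y s) P := fun s ↦
    (hm.comp measurable_prodMk_left).aestronglyMeasurable
  rw [eLpNorm_eq_lintegral_rpow_enorm_toReal (by norm_num) (by norm_num), one_div,
    ENNReal.rpow_inv_le_iff (by norm_num)]
  have hen : Measurable fun p : ℝ × Ω ↦ ‖Y p.1 p.2‖ₑ := hm.enorm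
  have hN : AEMeasurable (fun s ↦ eLpNorm (Y s) 2 P) μ := by
    have h2 : ∀ s, eLpNorm (Y s) 2 P =
        (∫⁻ ω, ‖Y s ω‖ₑ ^ (2 : ℝ≥0∞).toReal ∂P) ^ (1 / (2 : ℝ≥0∞).toReal) := fun s ↦
      eLpNorm_eq_lintegral_rpow_enorm_toReal (by norm_num) (by norm_num)
    simp_rw [h2]
    exact ((Measurable.lintegral_prod_right' (f := fun p : ℝ × Ω ↦
      ‖Y p.1 p.2‖ₑ ^ (2 : ℝ≥0∞).toReal) (hen.pow_const _)).pow_const _).aemeasurable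
  -- The square of the integral is bounded by a double integral over `(s, s')`; Tonelli moves the
  -- expectation inside, where Cauchy–Schwarz splits it into a product.
  calc ∫⁻ ω, ‖∫ s, Y s ω ∂μ‖ₑ ^ (2 : ℝ≥0∞).toReal ∂P
      ≤ ∫⁻ ω, (∫⁻ s, ‖Y s ω‖ₑ ∂μ) * (∫⁻ s', ‖Y s' ω‖ₑ ∂μ) ∂P := lintegral_mono fun ω ↦ by
        rw [ENNReal.toReal_ofNat, ENNReal.rpow_ofNat, pow_two]
        exact mul_le_mul' (enorm_integral_le_lintegral_enorm _) (enorm_integral_le_lintegral_enorm _)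
    _ = ∫⁻ ω, ∫⁻ s, ∫⁻ s', ‖Y s ω‖ₑ * ‖Y s' ω‖ₑ ∂μ ∂μ ∂P := by
        refine lintegral_congr fun ω ↦ ?_
        have h1 : Measurable fun s ↦ ‖Y s ω‖ₑ := hen.comp measurable_prodMk_right
        rw [← lintegral_mul_const _ h1]
        refine lintegral_congr fun s ↦ ?_
        rw [lintegral_const_mul _ h1]
    _ = ∫⁻ s, ∫⁻ s', ∫⁻ ω, ‖Y s ω‖ₑ * ‖Y s' ω‖ₑ ∂P ∂μ ∂μ := by
        rw [lintegral_lintegral_swap]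
        · refine lintegral_congr fun s ↦ ?_
          rw [lintegral_lintegral_swap]
          refine Measurable.aemeasurable ?_
          exact (hen.comp (measurable_const.prodMk measurable_fst)).mul
            (hen.comp (measurable_snd.prodMk measurable_fst))
        · refine Measurable.aemeasurable ?_
          refine Measurable.lintegral_prod_right' (f := fun q : (Ω × ℝ) × ℝ ↦
            ‖Y q.1.2 q.1.1‖ₑ * ‖Y q.2 q.1.1‖ₑ) ?_
          exact (hen.comp ((measurable_snd.comp measurable_fst).prodMk
            (measurable_fst.comp measurable_fst))).mul
            (hen.comp (measurable_snd.prodMk (measurable_fst.comp measurable_fst)))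
    _ ≤ ∫⁻ s, ∫⁻ s', eLpNorm (Y s) 2 P * eLpNorm (Y s') 2 P ∂μ ∂μ :=
        lintegral_mono fun s ↦ lintegral_mono fun s' ↦
          lintegral_enorm_mul_enorm_le (hY s) (hY s')
    _ ≤ (∫⁻ s, eLpNorm (Y s) 2 P ∂μ) * ∫⁻ s', eLpNorm (Y s') 2 P ∂μ := by
        rw [← lintegral_mul_const' _ _ hi]
        refine lintegral_mono_ae ?_
        -- Pulling the constant `‖Y s‖₂` out of the integral requires it to be finite, which is
        -- known only for almost every `s`.
        filter_upwards [ae_lt_top' hN hi] with s hs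
        rw [lintegral_const_mul' _ _ hs.ne]
    _ = (∫⁻ s, eLpNorm (Y s) 2 P ∂μ) ^ (2 : ℝ≥0∞).toReal := by
        rw [ENNReal.toReal_ofNat, ENNReal.rpow_ofNat, pow_two]

lemma memLp_integral_process (hm : Measurable (Function.uncurry Y))
    (hi : ∫⁻ s, eLpNorm (Y s) 2 P ∂μ ≠ ∞) : MemLp (fun ω ↦ ∫ s, Y s ω ∂μ) 2 P :=
  ⟨hm.stronglyMeasurable.integral_prod_left.aestronglyMeasurable,
    (eLpNorm_integral_process_le hm hi).trans_lt hi.lt_top⟩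

lemma integral_integral_process_mul (hm : Measurable (Function.uncurry Y))
    (hi : ∫⁻ s, eLpNorm (Y s) 2 P ∂μ ≠ ∞) (hV : MemLp V 2 P) :
    ∫ ω, (∫ s, Y s ω ∂μ) * V ω ∂P = ∫ s, ∫ ω, Y s ω * V ω ∂P ∂μ := by
  rw [integral_integral_swap (integrable_prod_process hm hi hV)]
  simp_rw [integral_mul_const]

lemma integral_integral_process (hm : Measurable (Function.uncurry Y))
    (hi : ∫⁻ s, eLpNorm (Y s) 2 P ∂μ ≠ ∞) :
    ∫ ω, (∫ s, Y s ω ∂μ) ∂P = ∫ s, ∫ ω, Y s ω ∂P ∂μ := by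
  simpa using integral_integral_process_mul hm hi (memLp_const (1 : ℝ))

lemma covariance_integral_process_left (hm : Measurable (Function.uncurry Y))
    (hY : ∀ s, MemLp (Y s) 2 P) (hi : ∫⁻ s, eLpNorm (Y s) 2 P ∂μ ≠ ∞) (hV : MemLp V 2 P) :
    cov[fun ω ↦ ∫ s, Y s ω ∂μ, V; P] = ∫ s, cov[Y s, V; P] ∂μ := by
  have h1 : Integrable (fun s ↦ ∫ ω, Y s ω * V ω ∂P) μ :=
    (integrable_prod_process hm hi hV).integral_prod_left
  have h2 : Integrable (fun s ↦ ∫ ω, Y s ω ∂P) μ := by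
    simpa using (integrable_prod_process hm hi (memLp_const (1 : ℝ))).integral_prod_left
  have h3 : ∀ s, cov[Y s, V; P] = ∫ ω, Y s ω * V ω ∂P - (∫ ω, Y s ω ∂P) * ∫ ω, V ω ∂P := fun s ↦
    covariance_eq_sub (hY s) hV
  simp_rw [h3]
  rw [covariance_eq_sub (memLp_integral_process hm hi) hV, integral_sub h1 (h2.mul_const _),
    integral_mul_const, ← integral_integral_process hm hi, ← integral_integral_process_mul hm hi hV]
  rfl

/-- A closed subspace is its double orthogonal complement, so it suffices to test against `v`
orthogonal to the span. By Fubini the inner product of `v` with the integral is the integral of the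
inner products with `Y s`, all zero. This avoids viewing the path integral as a Bochner integral in
`L²`. -/
lemma toLp_integral_process_mem_closedSpan {T : Type*} {X : T → Ω → ℝ}
    (hX : ∀ t, MemLp (X t) 2 P) (hm : Measurable (Function.uncurry Y))
    (hY : ∀ s, MemLp (Y s) 2 P) (hi : ∫⁻ s, eLpNorm (Y s) 2 P ∂μ ≠ ∞)
    (hYX : ∀ s, (hY s).toLp (Y s) ∈ closedSpan X P hX) :
    (memLp_integral_process hm hi).toLp (fun ω ↦ ∫ s, Y s ω ∂μ) ∈ closedSpan X P hX := by
  have hcl : closedSpan X P hX = (closedSpan X P hX)ᗮᗮ := by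
    rw [closedSpan, Submodule.orthogonal_orthogonal_eq_closure,
      (Submodule.isClosed_topologicalClosure _).submodule_topologicalClosure_eq]
  rw [hcl, Submodule.mem_orthogonal]
  intro v hv
  have hin : ∀ {f : Ω → ℝ} (hf : MemLp f 2 P), inner ℝ v (hf.toLp f) = ∫ ω, f ω * v ω ∂P := by
    intro f hf
    rw [L2.inner_def]
    refine integral_congr_ae ?_
    filter_upwards [hf.coeFn_toLp] with ω h
    simp [h]
  rw [hin, integral_integral_process_mul hm hi (Lp.memLp v)]
  refine integral_eq_zero_of_ae (ae_of_all _ fun s ↦ ?_)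
  simp only [Pi.zero_apply]
  rw [← hin (hY s), real_inner_comm]
  exact (Submodule.mem_orthogonal _ _).1 hv _ (hYX s)

end ProcessIntegral

/-! ### Positive semidefinite matrices as quadratic forms -/

section PosSemidef

lemma posSemidef_of_iff {α : Type*} [Fintype α] {c : α → α → ℝ} :
    (Matrix.of c).PosSemidef ↔
      (∀ a b, c a b = c b a) ∧ ∀ x : α → ℝ, 0 ≤ ∑ a, ∑ b, x a * x b * c a b := by
  rw [Matrix.posSemidef_iff_dotProduct_mulVec]
  refine and_congr ?_ (forall_congr' fun x ↦ ?_)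
  · rw [Matrix.IsHermitian, ← Matrix.ext_iff]
    simp only [Matrix.conjTranspose_apply, Matrix.of_apply, star_trivial]
    exact forall_comm
  · simp only [dotProduct, Matrix.mulVec, star_trivial, Matrix.of_apply, Finset.mul_sum]
    refine iff_of_eq (congrArg _ (Finset.sum_congr rfl fun a _ ↦ Finset.sum_congr rfl fun b _ ↦ ?_))
    ring

lemma posSemidef_covariance {Ω : Type*} [MeasurableSpace Ω] {P : Measure Ω}
    [IsProbabilityMeasure P] {α : Type*} [Fintype α] {X : α → Ω → ℝ} (hX : ∀ a, MemLp (X a) 2 P) :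
    (Matrix.of fun a b ↦ cov[X a, X b; P]).PosSemidef := by
  refine posSemidef_of_iff.2 ⟨fun a b ↦ covariance_comm _ _, fun x ↦ ?_⟩
  have hx : ∀ a, MemLp (fun ω ↦ x a * X a ω) 2 P := fun a ↦ (hX a).const_mul _
  have h := covariance_fun_sum_fun_sum (X := fun a ω ↦ x a * X a ω)
    (Y := fun a ω ↦ x a * X a ω) hx hx
  simp_rw [covariance_const_mul_left, covariance_const_mul_right, ← mul_assoc] at h
  rw [← h, covariance_self (memLp_finsetSum _ fun a _ ↦ hx a).aestronglyMeasurable.aemeasurable]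
  exact variance_nonneg _ _

lemma posSemidef_of_tendsto {α β : Type*} [Fintype α] {l : Filter β} [l.NeBot]
    {c : β → α → α → ℝ} {c' : α → α → ℝ} (hc : ∀ n, (Matrix.of (c n)).PosSemidef)
    (h : ∀ a b, Tendsto (fun n ↦ c n a b) l (𝓝 (c' a b))) : (Matrix.of c').PosSemidef := by
  simp_rw [posSemidef_of_iff] at hc ⊢
  refine ⟨fun a b ↦ tendsto_nhds_unique (h a b) ?_, fun x ↦ ?_⟩
  · simp_rw [fun n ↦ (hc n).1 a b]
    exact h b a
  · refine ge_of_tendsto' (tendsto_finsetSum _ fun a _ ↦ tendsto_finsetSum _ fun b _ ↦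
      (h a b).const_mul (x a * x b)) fun n ↦ (hc n).2 x

end PosSemidef

/-! ### Lévy–Prokhorov comparison of Gaussian laws -/

section LongTime

lemma hasGaussianLaw_pi_of_isGaussianProcess {Ω : Type*} [MeasurableSpace Ω] {P : Measure Ω}
    {α : Type*} [Fintype α] {X : α → Ω → ℝ} (hX : IsGaussianProcess X P) :
    HasGaussianLaw (fun ω a ↦ X a ω) P := by
  let L : (↥(Finset.univ : Finset α) → ℝ) →L[ℝ] (α → ℝ) :=
    ContinuousLinearMap.pi fun a ↦ ContinuousLinearMap.proj ⟨a, Finset.mem_univ a⟩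
  exact (hX.hasGaussianLaw Finset.univ).map L

lemma map_eq_multivariateGaussian {Ω : Type*} [MeasurableSpace Ω] {P : Measure Ω}
    [IsProbabilityMeasure P] {α : Type*} [Fintype α] [DecidableEq α] {X : α → Ω → ℝ}
    (hX : IsGaussianProcess X P) :
    P.map (fun ω ↦ (WithLp.toLp 2 fun a ↦ X a ω : EuclideanSpace ℝ α)) =
      multivariateGaussian (WithLp.toLp 2 fun a ↦ ∫ ω, X a ω ∂P)
        (Matrix.of fun a b ↦ cov[X a, X b; P]) := by
  have hL := (hasGaussianLaw_pi_of_isGaussianProcess hX).toLp_pi 2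
  have h2 : ∀ a, MemLp (X a) 2 P := fun a ↦ (hX.hasGaussianLaw_eval a).memLp_two
  have := hL.isGaussian_map
  apply IsGaussian.ext
  · rw [integral_id_multivariateGaussian', integral_map hL.aemeasurable (by fun_prop)]
    ext a
    have h3 : Integrable (fun ω ↦ (WithLp.toLp 2 fun a ↦ X a ω : EuclideanSpace ℝ α)) P :=
      hL.integrable
    have := (EuclideanSpace.proj (𝕜 := ℝ) a : EuclideanSpace ℝ α →L[ℝ] ℝ).integral_comp_comm h3
    simpa using this.symm
  · ext x y
    rw [covarianceBilin_apply_pi h2, covarianceBilin_multivariateGaussian (posSemidef_covariance h2)]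
    simp only [dotProduct, Matrix.mulVec, Matrix.of_apply, Finset.mul_sum]
    refine Finset.sum_congr rfl fun a _ ↦ Finset.sum_congr rfl fun b _ ↦ ?_
    ring

/-- This supplies the coupling for the Lévy–Prokhorov bound: the law with the larger covariance is
that of the original vector plus independent centred noise of covariance `R`. -/
lemma multivariateGaussian_add {α : Type*} [Fintype α] [DecidableEq α] (m : EuclideanSpace ℝ α)
    {S R : Matrix α α ℝ} (hS : S.PosSemidef) (hR : R.PosSemidef) :
    multivariateGaussian m (S + R) = multivariateGaussian m S ∗ multivariateGaussian 0 R := by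
  apply Measure.ext_of_charFun
  ext x
  rw [charFun_conv, charFun_multivariateGaussian (hS.add hR), charFun_multivariateGaussian hS,
    charFun_multivariateGaussian hR, ← Complex.exp_add, Matrix.add_mulVec, dotProduct_add]
  congr 1
  simp
  ring

lemma integral_norm_sq_multivariateGaussian {α : Type*} [Fintype α] [DecidableEq α]
    {R : Matrix α α ℝ} (hR : R.PosSemidef) :
    Integrable (fun z ↦ ‖z‖ ^ 2) (multivariateGaussian 0 R) ∧
      ∫ z, ‖z‖ ^ 2 ∂(multivariateGaussian 0 R) = R.trace := by
  have h2 : ∀ a, MemLp (fun z : EuclideanSpace ℝ α ↦ z a) 2 (multivariateGaussian 0 R) := fun a ↦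
    (IsGaussian.hasGaussianLaw_id.map
      (EuclideanSpace.proj (𝕜 := ℝ) a : EuclideanSpace ℝ α →L[ℝ] ℝ)).memLp_two
  have h0 : ∀ a, ∫ z, z a ∂(multivariateGaussian 0 R) = 0 := fun a ↦ by
    have h := (EuclideanSpace.proj (𝕜 := ℝ) a : EuclideanSpace ℝ α →L[ℝ] ℝ).integral_comp_comm
      (IsGaussian.integrable_id (μ := multivariateGaussian 0 R))
    rw [integral_id_multivariateGaussian'] at h
    simpa using h
  have hv : ∀ a, ∫ z, (z a) ^ 2 ∂(multivariateGaussian 0 R) = R a a := fun a ↦ by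
    rw [← variance_eval_multivariateGaussian (μ := 0) hR a,
      variance_of_integral_eq_zero (h2 a).aestronglyMeasurable.aemeasurable (h0 a)]
  simp_rw [EuclideanSpace.norm_sq_eq, Real.norm_eq_abs, sq_abs]
  refine ⟨integrable_finsetSum _ fun a _ ↦ (h2 a).integrable_sq, ?_⟩
  rw [integral_finsetSum _ fun a _ ↦ (h2 a).integrable_sq]
  simp [hv, Matrix.trace]

/-- Adding independent noise `z` of covariance `R` moves the vector by at least `δ` with probability
at most `R.trace / δ ^ 2` by Chebyshev. The cube in the hypothesis makes this at most `δ`, so the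
same `δ` serves as distance and as probability. Between probability measures one of the two defining
inequalities suffices. -/
lemma levyProkhorovEDist_multivariateGaussian_le {α : Type*} [Fintype α] [DecidableEq α]
    (m : EuclideanSpace ℝ α) {S R : Matrix α α ℝ} (hS : S.PosSemidef) (hR : R.PosSemidef)
    {δ : ℝ} (hδ : 0 < δ) (h : R.trace ≤ δ ^ 3) :
    levyProkhorovEDist (multivariateGaussian m S) (multivariateGaussian m (S + R)) ≤
      ENNReal.ofReal δ := by
  refine levyProkhorovEDist_le_of_forall_le _ _ _ fun ε B hε hε' hB ↦ ?_
  set μ := multivariateGaussian m S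
  set ν := multivariateGaussian 0 R with hν
  have hδε : δ ≤ ε.toReal := by
    rw [← ENNReal.ofReal_le_iff_le_toReal hε'.ne]
    exact hε.le
  have htail : ν {z | δ ^ 2 ≤ ‖z‖ ^ 2} ≤ ε := by
    have h1 := mul_meas_ge_le_integral_of_nonneg (μ := ν) (ae_of_all _ fun z ↦ by positivity)
      (integral_norm_sq_multivariateGaussian hR).1 (δ ^ 2)
    rw [(integral_norm_sq_multivariateGaussian hR).2] at h1
    have h2 : ν.real {z | δ ^ 2 ≤ ‖z‖ ^ 2} ≤ δ := by
      have : 0 < δ ^ 2 := by positivity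
      nlinarith
    refine le_trans ?_ hε.le
    rw [← ofReal_measureReal]
    exact ENNReal.ofReal_le_ofReal h2
  have hT : MeasurableSet (Metric.thickening ε.toReal B) := Metric.isOpen_thickening.measurableSet
  rw [multivariateGaussian_add m hS hR, Measure.conv, Measure.map_apply (by fun_prop) hT]
  calc μ B = (μ.prod ν) (B ×ˢ Set.univ) := by rw [Measure.prod_prod, measure_univ, mul_one]
    -- Either the noise has norm at least `δ`, or the sum stays within `δ ≤ ε.toReal` of the point
    -- of `B`.
    _ ≤ (μ.prod ν) ((fun p ↦ p.1 + p.2) ⁻¹' Metric.thickening ε.toReal B ∪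
          Set.univ ×ˢ {z | δ ^ 2 ≤ ‖z‖ ^ 2}) := by
        refine measure_mono fun p hp ↦ ?_
        by_cases hz : δ ≤ ‖p.2‖
        · exact Or.inr ⟨trivial, pow_le_pow_left₀ hδ.le hz 2⟩
        · refine Or.inl (Metric.mem_thickening_iff.2 ⟨p.1, hp.1, ?_⟩)
          rw [dist_eq_norm, add_sub_cancel_left]
          exact (not_le.1 hz).trans_le hδε
    _ ≤ _ := (measure_union_le _ _).trans (by
        gcongr
        rw [Measure.prod_prod, measure_univ, one_mul]
        exact htail)

/-- If the covariance function of a Gaussian process differs from `c` by a positive semidefinite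
kernel which vanishes when one of the two times tends to infinity, then the process is `GP(m, c)`
in the long time regime. -/
lemma isLongTimeGP_of_isGP {Ω ι : Type*} [MeasurableSpace Ω] {P : Measure Ω}
    [IsProbabilityMeasure P] {X : ι → ℝ≥0 → Ω → ℝ} {m : ι → ℝ≥0 → ℝ}
    {c₀ R c : ι → ι → ℝ≥0 → ℝ≥0 → ℝ}
    (hX : IsGP P (fun p : ι × ℝ≥0 ↦ X p.1 p.2) (fun p ↦ m p.1 p.2)
      (fun p p' ↦ c₀ p.1 p'.1 p.2 p'.2))
    (hR : ∀ (n : ℕ) (i : Fin n → ι) (t : Fin n → ℝ≥0),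
      (Matrix.of fun a b ↦ R (i a) (i b) (t a) (t b)).PosSemidef)
    (hR0 : ∀ i j, Tendsto (fun p : ℝ≥0 × ℝ≥0 ↦ R i j p.1 p.2) (Filter.coprod atTop atTop) (𝓝 0))
    (hc : ∀ i j t t', c i j t t' = c₀ i j t t' + R i j t t') :
    IsLongTimeGP P X m c := by
  have h2 : ∀ p : ι × ℝ≥0, MemLp (X p.1 p.2) 2 P := fun p ↦
    (hX.gaussian.hasGaussianLaw_eval p).memLp_two
  have hcov : ∀ i j t t', cov[X i t, X j t'; P] = c₀ i j t t' := fun i j t t' ↦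
    hX.cov (i, t) (j, t')
  have hS : ∀ (n : ℕ) (i : Fin n → ι) (t : Fin n → ℝ≥0),
      (Matrix.of fun a b ↦ c₀ (i a) (i b) (t a) (t b)).PosSemidef := fun n i t ↦ by
    have := posSemidef_covariance (X := fun a : Fin n ↦ X (i a) (t a)) fun a ↦ h2 (i a, t a)
    simpa only [hcov] using this
  have hadd : ∀ (n : ℕ) (i : Fin n → ι) (t : Fin n → ℝ≥0),
      (Matrix.of fun a b ↦ c (i a) (i b) (t a) (t b)) =
      (Matrix.of fun a b ↦ c₀ (i a) (i b) (t a) (t b)) +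
      (Matrix.of fun a b ↦ R (i a) (i b) (t a) (t b)) := fun n i t ↦ by
    ext a b; simp [hc]
  refine ⟨hX.gaussian, fun i t ↦ hX.mean (i, t), fun i j ↦ ?_, fun n i t ↦ ?_, fun n i ↦ ?_⟩
  · simpa [hcov, hc] using (hR0 i j).neg
  · rw [hadd]
    exact (hS n i t).add (hR n i t)
  · have htr : Tendsto (fun t : Fin n → ℝ≥0 ↦
        (Matrix.of fun a b ↦ R (i a) (i b) (t a) (t b)).trace) atTop (𝓝 0) := by
      -- The trace only sees equal times; the diagonal tends to the coproduct filter because one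
      -- diverging coordinate is enough.
      have hdiag : Tendsto (fun s : ℝ≥0 ↦ (s, s)) atTop (Filter.coprod atTop atTop) := by
        have h : Tendsto (fun s : ℝ≥0 ↦ (s, s)) atTop (comap Prod.fst atTop) :=
          tendsto_comap_iff.2 tendsto_id
        exact h.mono_right le_sup_left
      have heval : ∀ a, Tendsto (fun t : Fin n → ℝ≥0 ↦ t a) atTop atTop := fun a ↦
        tendsto_atTop.2 fun b ↦ by
          filter_upwards [eventually_ge_atTop fun _ ↦ b] with t ht using ht a
      have := tendsto_finsetSum (Finset.univ : Finset (Fin n)) fun a _ ↦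
        ((hR0 (i a) (i a)).comp hdiag).comp (heval a)
      simpa [Matrix.trace] using this
    rw [ENNReal.tendsto_nhds_zero]
    intro ε hε
    -- The tolerance may be `∞`, so it is truncated at `1` before being turned into a real number.
    obtain ⟨δ, hδ0, hδ⟩ : ∃ δ : ℝ, 0 < δ ∧ ENNReal.ofReal δ ≤ ε := by
      refine ⟨(min ε 1).toReal, ENNReal.toReal_pos (by simp [hε.ne']) (by simp), ?_⟩
      rw [ENNReal.ofReal_toReal (by simp)]
      exact min_le_left _ _
    filter_upwards [htr.eventually_le_const (show (0 : ℝ) < δ ^ 3 by positivity)] with t ht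
    refine le_trans ?_ hδ
    have hmap := map_eq_multivariateGaussian (P := P) (X := fun a : Fin n ↦ X (i a) (t a))
      (hX.gaussian.comp_right fun a ↦ (i a, t a))
    rw [hmap, hadd]
    simp_rw [hcov, fun a ↦ hX.mean (i a, t a)]
    exact levyProkhorovEDist_multivariateGaussian_le _ (hS n i t) (hR n i t) hδ0 ht

end LongTime

/-! ### Spectrum of the feedback matrix -/

section Diagonalisation

variable {k : ℕ} {C κ : Fin k → ℝ} {ε : ℝ}

lemma below_nonneg (hκ : ∀ i, 0 < κ i) (hε : 0 < ε) (i : Fin k) : 0 ≤ below κ ε i := by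
  unfold below
  split_ifs with h h2
  · exact (mul_pos hε (hκ _)).le
  · simpa using (hκ _).le
  · exact le_rfl

lemma feedback_mulVec (x : Fin k → ℝ) (i : Fin k) :
    (feedback C κ ε *ᵥ x) i = -(κ i + below κ ε i) / C i * x i +
      (if h : i.val + 1 < k then below κ ε i / C i * x ⟨i.val + 1, h⟩ else 0) +
      (if h : 0 < i.val then κ i / C i * x ⟨i.val - 1, by omega⟩ else 0) := by
  have hsplit : ∀ j, feedback C κ ε i j * x j =
      (if j = i then -(κ i + below κ ε i) / C i * x i else 0) +
      (if j.val = i.val + 1 then below κ ε i / C i * x j else 0) +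
      (if i.val = j.val + 1 then κ i / C i * x j else 0) := fun j ↦ by
    simp only [feedback, Matrix.of_apply]
    by_cases h1 : j = i
    · subst h1; simp
    · by_cases h2 : j.val = i.val + 1
      · have h3 : ¬ i.val = j.val + 1 := by omega
        rw [if_neg h1, if_pos h2, if_neg h1, if_pos h2, if_neg h3]
        ring
      · rw [if_neg h1, if_neg h2, if_neg h1, if_neg h2]
        split_ifs <;> ring
  simp only [Matrix.mulVec, dotProduct, hsplit, Finset.sum_add_distrib]
  congr 1
  · congr 1
    · simp
    · split_ifs with h
      · rw [Finset.sum_eq_single ⟨i.val + 1, h⟩]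
        · simp
        · intro j _ hj
          rw [if_neg fun h' ↦ hj (Fin.ext h')]
        · simp
      · exact Finset.sum_eq_zero fun j _ ↦ if_neg (by omega)
  · split_ifs with h
    · rw [Finset.sum_eq_single ⟨i.val - 1, by omega⟩]
      · rw [if_pos (by simp only; omega)]
      · intro j _ hj
        rw [if_neg fun h' ↦ hj (Fin.ext (by simp only; omega))]
      · simp
    · exact Finset.sum_eq_zero fun j _ ↦ if_neg (by omega)

/-- The feedback matrix has no eigenvector with a nonnegative eigenvalue. -/
lemma eq_zero_of_feedback_mulVec_eq (hC : ∀ i, 0 < C i) (hκ : ∀ i, 0 < κ i) (hε : 0 < ε)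
    {x : Fin k → ℝ} {μ : ℝ} (hμ : 0 ≤ μ) (hx : feedback C κ ε *ᵥ x = μ • x) : x = 0 := by
  by_contra hne
  obtain ⟨i₀, hi₀⟩ := Function.ne_iff.1 hne
  have : Nonempty (Fin k) := ⟨i₀⟩
  obtain ⟨m, hm⟩ := Finite.exists_max fun i ↦ |x i|
  have hM : 0 < |x m| := (abs_pos.2 hi₀).trans_le (hm i₀)
  -- Row `i` of the eigenvector equation, multiplied by `C i` and put in absolute values. The
  -- eigenvalue contributes `μ * C i ≥ 0` on the left and may be dropped.
  have key : ∀ i : Fin k, (κ i + below κ ε i) * |x i| ≤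
      (if h : i.val + 1 < k then below κ ε i * |x ⟨i.val + 1, h⟩| else 0) +
      (if h : 0 < i.val then κ i * |x ⟨i.val - 1, by omega⟩| else 0) := fun i ↦ by
    have h := congrFun hx i
    rw [feedback_mulVec, Pi.smul_apply, smul_eq_mul] at h
    have hCi := hC i
    have hb := below_nonneg hκ hε i
    have hk := hκ i
    have h' : (μ * C i + (κ i + below κ ε i)) * x i =
        (if h : i.val + 1 < k then below κ ε i * x ⟨i.val + 1, h⟩ else 0) +
        (if h : 0 < i.val then κ i * x ⟨i.val - 1, by omega⟩ else 0) := by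
      split_ifs at h ⊢ <;> field_simp at h <;> linarith
    have h2 := congrArg abs h'
    rw [abs_mul, abs_of_pos (by positivity : 0 < μ * C i + (κ i + below κ ε i))] at h2
    have h3 : (κ i + below κ ε i) * |x i| ≤ (μ * C i + (κ i + below κ ε i)) * |x i| := by
      have : 0 ≤ μ * C i * |x i| := by positivity
      linarith
    refine (h3.trans_eq h2).trans ((abs_add_le _ _).trans (add_le_add ?_ ?_))
    · split_ifs
      · rw [abs_mul, abs_of_nonneg hb]
      · simp
    · split_ifs
      · rw [abs_mul, abs_of_pos hk]
      · simp
  have hup : ∀ i : Fin k, |x i| = |x m| →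
      (if h : i.val + 1 < k then below κ ε i * |x ⟨i.val + 1, h⟩| else 0) ≤
        below κ ε i * |x m| := fun i _ ↦ by
    have hb := below_nonneg hκ hε i
    split_ifs with h
    · exact mul_le_mul_of_nonneg_left (hm _) hb
    · positivity
  -- Maximum principle: if `|x|` is maximal at a box, the exchange with the box below is at most
  -- `below * |x m|` and cancels, so `|x|` is maximal at the box above too. At the uppermost box
  -- nothing balances the loss term `κ * |x m| > 0`.
  have hind : ∀ (n : ℕ) (hn : n < k), |x ⟨n, hn⟩| ≠ |x m| := by
    intro n
    induction n with
    | zero =>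
      intro hn h
      have h1 := key ⟨0, hn⟩
      have h2 := hup _ h
      rw [h] at h1
      simp only [lt_irrefl, dite_false, add_zero] at h1
      have := mul_pos (hκ ⟨0, hn⟩) hM
      linarith
    | succ n ih =>
      intro hn h
      have h1 := key ⟨n + 1, hn⟩
      have h2 := hup _ h
      rw [h] at h1
      simp only [Nat.zero_lt_succ, dite_true, Nat.add_sub_cancel] at h1
      have h3 : κ ⟨n + 1, hn⟩ * |x m| ≤ κ ⟨n + 1, hn⟩ * |x ⟨n, by omega⟩| := by linarith
      exact ih (by omega) (le_antisymm (hm _) (le_of_mul_le_mul_left h3 (hκ _)))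
  exact hind m.val m.isLt rfl

/-- A left eigenvector of the feedback matrix does not vanish at the uppermost box. -/
lemma eq_zero_of_vecMul_feedback_eq (hC : ∀ i, 0 < C i) (hκ : ∀ i, 0 < κ i)
    {y : Fin k → ℝ} {μ : ℝ} (hy : y ᵥ* feedback C κ ε = μ • y)
    (h0 : ∀ i : Fin k, i.val = 0 → y i = 0) : y = 0 := by
  have hind : ∀ (n : ℕ) (hn : n < k), y ⟨n, hn⟩ = 0 := by
    intro n
    induction n using Nat.strong_induction_on with
    | _ n ih =>
      intro hn
      rcases n with _ | n
      · exact h0 _ rfl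
      -- Column `n` of the equation involves only `y` at `n - 1`, `n` and `n + 1`. The first two
      -- vanish by induction, and the subdiagonal entry `κ / C` multiplying the third is nonzero.
      · have h := congrFun hy ⟨n, by omega⟩
        rw [Pi.smul_apply, ih n (by omega), smul_zero, Matrix.vecMul, dotProduct,
          Finset.sum_eq_single ⟨n + 1, hn⟩] at h
        · have hA : feedback C κ ε ⟨n + 1, hn⟩ ⟨n, by omega⟩ =
              κ ⟨n + 1, hn⟩ / C ⟨n + 1, hn⟩ := by
            simp [feedback]
            omega
          rw [hA] at h
          exact (mul_eq_zero.1 h).resolve_right (div_pos (hκ _) (hC _)).ne'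
        · intro j _ hj
          by_cases hjn : j.val < n + 1
          · rw [ih j.val hjn j.isLt, zero_mul]
          · have hj' : j.val ≠ n + 1 := fun h ↦ hj (Fin.ext h)
            have : feedback C κ ε j ⟨n, by omega⟩ = 0 := by
              simp only [feedback, Matrix.of_apply]
              rw [if_neg fun h ↦ hjn (by have h' : n = j.val := congrArg Fin.val h; omega), if_neg (by omega), if_neg (by omega)]
            rw [this, mul_zero]
        · simp
  exact funext fun i ↦ hind i.val i.isLt

variable {Φ : Matrix (Fin k) (Fin k) ℝ} {d q : Fin k → ℝ}

lemma inv_mul_feedback {A : Matrix (Fin k) (Fin k) ℝ} {b : Fin k → ℝ}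
    (hΦ : IsDiagonalisation A b Φ d q) :
    Φ⁻¹ * A = Matrix.diagonal (fun i ↦ -1 / d i) * Φ⁻¹ := by
  rw [hΦ.feedback_eq, ← Matrix.mul_assoc, ← Matrix.mul_assoc, Matrix.nonsing_inv_mul _ hΦ.isUnit,
    Matrix.one_mul]

/-- Column `i` of `Φ` is a right eigenvector and row `i` of `Φ⁻¹` a left eigenvector for `-1 / d i`;
neither is zero as `Φ` is invertible. The uppermost entry of that row is proportional to `q i / d
i`, hence would vanish with `q i`. -/
lemma pos_and_ne_zero_of_isDiagonalisation (hC : ∀ i, 0 < C i) (hκ : ∀ i, 0 < κ i) (hε : 0 < ε)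
    (hΦ : IsDiagonalisation (feedback C κ ε) (forcingVec C) Φ d q) (i : Fin k) :
    0 < d i ∧ q i ≠ 0 := by
  have hd : 0 < d i := by
    by_contra hd
    -- This includes `d i = 0`, where `-1 / d i` is `0` by convention: the maximum principle also
    -- excludes the eigenvalue `0`.
    have hμ : 0 ≤ -1 / d i := div_nonneg_of_nonpos (by norm_num) (not_lt.1 hd)
    have hx : feedback C κ ε *ᵥ (Φ *ᵥ Pi.single i 1) = (-1 / d i) • (Φ *ᵥ Pi.single i 1) := by
      conv_lhs => rw [hΦ.feedback_eq]
      rw [Matrix.mulVec_mulVec, Matrix.mul_assoc, Matrix.nonsing_inv_mul _ hΦ.isUnit,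
        Matrix.mul_one, ← Matrix.mulVec_mulVec, ← Matrix.mulVec_smul]
      congr 1
      ext j
      rw [Matrix.mulVec_diagonal]
      by_cases h : j = i
      · subst h; simp
      · simp [h]
    have h0 := eq_zero_of_feedback_mulVec_eq hC hκ hε hμ hx
    have h1 : Φ⁻¹ *ᵥ (Φ *ᵥ Pi.single i 1) = (Pi.single i 1 : Fin k → ℝ) := by
      rw [Matrix.mulVec_mulVec, Matrix.nonsing_inv_mul _ hΦ.isUnit, Matrix.one_mulVec]
    rw [h0, Matrix.mulVec_zero] at h1
    simpa using congrFun h1 i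
  refine ⟨hd, fun hq ↦ ?_⟩
  have hrow : (Φ⁻¹ i) ᵥ* feedback C κ ε = (-1 / d i) • Φ⁻¹ i := by
    have h := congrFun (inv_mul_feedback hΦ) i
    ext j
    have := congrFun h j
    rw [Matrix.diagonal_mul] at this
    exact this
  have h0 : ∀ j : Fin k, j.val = 0 → Φ⁻¹ i j = 0 := fun j hj ↦ by
    have h := hΦ.forcing_eq i
    rw [hq, zero_div, Matrix.mulVec, dotProduct, Finset.sum_eq_single j] at h
    · rw [forcingVec, if_pos hj] at h
      exact (mul_eq_zero.1 h).resolve_right (one_div_pos.2 (hC j)).ne'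
    · intro l _ hl
      rw [forcingVec, if_neg fun h' ↦ hl (Fin.ext (h'.trans hj.symm)), mul_zero]
    · simp
  have hz := eq_zero_of_vecMul_feedback_eq hC hκ hrow h0
  have h1 := congrFun (congrFun (Matrix.nonsing_inv_mul _ hΦ.isUnit) i) i
  rw [Matrix.mul_apply, Matrix.one_apply_eq, hz] at h1
  simp at h1

lemma eq_temperature {Ω : Type*} {hk : 0 < k} (hΦ : IsUnit Φ.det) (h1 : ∀ j, Φ ⟨0, hk⟩ j = 1)
    (X : ℝ≥0 → Ω → Fin k → ℝ) (t : ℝ≥0) (ω : Ω) : X t ω ⟨0, hk⟩ = temperature Φ X t ω := by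
  have h : Φ *ᵥ (Φ⁻¹ *ᵥ X t ω) = X t ω := by
    rw [Matrix.mulVec_mulVec, Matrix.mul_nonsing_inv _ hΦ, Matrix.one_mulVec]
  conv_lhs => rw [← h]
  simp [Matrix.mulVec, dotProduct, h1, temperature, thermal]

end Diagonalisation

/-! ### The kernels `etaCov` and `gammaCross` and their difference -/

section Kernels

variable {k : ℕ} {d q : Fin k → ℝ}

lemma etaCov_of_le (hd : ∀ i, 0 < d i) (i j : Fin k) {t t' : ℝ≥0} (h : t ≤ t') :
    etaCov d q i j t t' = q i * q j / (d i + d j) * (Real.exp (-|(t : ℝ) - t'| / d j) -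
        Real.exp (-(d j * t + d i * t') / (d i * d j))) := by
  have hi := (hd i).ne'
  have hj := (hd j).ne'
  have h' : (t : ℝ) ≤ t' := by exact_mod_cast h
  rw [etaCov, mul_assoc, mul_sub, ← Real.exp_add, mul_one, min_eq_left h',
    abs_of_nonpos (by linarith)]
  congr 4
  field_simp
  ring

lemma etaCov_comm (i j : Fin k) (t t' : ℝ≥0) : etaCov d q i j t t' = etaCov d q j i t' t := by
  unfold etaCov
  rw [mul_comm (q i), add_comm (d i), add_comm (d j * (t : ℝ)), mul_comm (d i) (d j), min_comm]

lemma etaCov_of_ge (hd : ∀ i, 0 < d i) (i j : Fin k) {t t' : ℝ≥0} (h : t' ≤ t) :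
    etaCov d q i j t t' = q i * q j / (d i + d j) * (Real.exp (-|(t : ℝ) - t'| / d i) -
        Real.exp (-(d j * t + d i * t') / (d i * d j))) := by
  rw [etaCov_comm, etaCov_of_le hd j i h, mul_comm (q i), add_comm (d i), abs_sub_comm,
    add_comm (d j * (t : ℝ)), mul_comm (d i) (d j)]

/-- The part of the long-time cross-covariance which is missing at finite times. -/
noncomputable def memory (d q : Fin k → ℝ) (i j : Fin k) (t t' : ℝ≥0) : ℝ :=
  q i * q j / (d i + d j) * (Real.exp (-(t : ℝ) / d i) * Real.exp (-(t' : ℝ) / d j))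

lemma gammaCross_eq_etaCov_add (hd : ∀ i, 0 < d i) (i j : Fin k) (t t' : ℝ≥0) :
    gammaCross d q i j t t' = etaCov d q i j t t' + memory d q i j t t' := by
  have hi := (hd i).ne'
  have hj := (hd j).ne'
  have he : Real.exp (-(t : ℝ) / d i) * Real.exp (-(t' : ℝ) / d j) =
      Real.exp (-(d j * t + d i * t') / (d i * d j)) := by
    rw [← Real.exp_add]
    congr 1
    field_simp
    ring
  rw [memory, he, gammaCross]
  split_ifs with h
  · rw [etaCov_of_le hd i j h]; ring
  · rw [etaCov_of_ge hd i j (not_le.1 h).le]; ring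

/-- In the product of the two exponentials one factor tends to `0` and the other is at most `1`, so
it suffices that one of the times diverges. -/
lemma tendsto_memory (hd : ∀ i, 0 < d i) (i j : Fin k) :
    Tendsto (fun p : ℝ≥0 × ℝ≥0 ↦ memory d q i j p.1 p.2) (Filter.coprod atTop atTop) (𝓝 0) := by
  have hexp : ∀ i, Tendsto (fun t : ℝ≥0 ↦ Real.exp (-(t : ℝ) / d i)) atTop (𝓝 0) := fun i ↦ by
    refine Real.tendsto_exp_atBot.comp ?_
    simp_rw [neg_div]
    exact tendsto_neg_atTop_atBot.comp
      ((NNReal.tendsto_coe_atTop.2 tendsto_id).atTop_div_const (hd i))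
  have hle : ∀ i (t : ℝ≥0), Real.exp (-(t : ℝ) / d i) ≤ 1 := fun i t ↦ by
    rw [Real.exp_le_one_iff]
    exact div_nonpos_of_nonpos_of_nonneg (neg_nonpos.2 t.2) (hd i).le
  rw [show (0 : ℝ) = q i * q j / (d i + d j) * 0 by ring]
  refine Tendsto.const_mul _ (tendsto_sup.2 ⟨?_, ?_⟩)
  · refine squeeze_zero (fun p ↦ by positivity) (fun p ↦ ?_) ((hexp i).comp tendsto_comap)
    exact mul_le_of_le_one_right (Real.exp_pos _).le (hle _ _)
  · refine squeeze_zero (fun p ↦ by positivity) (fun p ↦ ?_) ((hexp j).comp tendsto_comap)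
    exact mul_le_of_le_one_left (Real.exp_pos _).le (hle _ _)

lemma isEquivalent_etaCov_gammaCross (hd : ∀ i, 0 < d i) (i j : Fin k) :
    Asymptotics.IsEquivalent (atTop : Filter (ℝ≥0 × ℝ≥0))
      (fun p ↦ etaCov d q i j p.1 p.2) (fun p ↦ gammaCross d q i j p.1 p.2) := by
  have hi := (hd i).ne'
  have hj := (hd j).ne'
  -- The relative error of `gammaCross` is exactly `e^{-(1/d i + 1/d j) min(t, t')}`, which vanishes
  -- only when both times diverge. Writing it as a factor avoids dividing by `gammaCross`.
  have hb : ∀ t t' : ℝ≥0, memory d q i j t t' =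
      Real.exp (-((1 / d i + 1 / d j) * (min t t' : ℝ≥0))) * gammaCross d q i j t t' := by
    intro t t'
    rw [memory, gammaCross, mul_left_comm (Real.exp _), ← Real.exp_add, ← Real.exp_add]
    congr 2
    split_ifs with h
    · have h' : (t : ℝ) ≤ t' := by exact_mod_cast h
      rw [min_eq_left h, abs_of_nonpos (by linarith)]
      field_simp
      ring
    · have h2 := (not_le.1 h).le
      have h' : (t' : ℝ) ≤ t := by exact_mod_cast h2
      rw [min_eq_right h2, abs_of_nonneg (by linarith)]
      field_simp
      ring
  have hmin : Tendsto (fun p : ℝ≥0 × ℝ≥0 ↦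
      Real.exp (-((1 / d i + 1 / d j) * (min p.1 p.2 : ℝ≥0)))) atTop (𝓝 0) := by
    refine Real.tendsto_exp_neg_atTop_nhds_zero.comp (Tendsto.const_mul_atTop ?_ ?_)
    · have := hd i; have := hd j; positivity
    · refine NNReal.tendsto_coe_atTop.2 (tendsto_atTop.2 fun b ↦ ?_)
      filter_upwards [eventually_ge_atTop (b, b)] with p hp using le_min hp.1 hp.2
  have ho : (fun p : ℝ≥0 × ℝ≥0 ↦ memory d q i j p.1 p.2) =o[atTop]
      fun p ↦ gammaCross d q i j p.1 p.2 := by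
    exact Asymptotics.isLittleO_iff_exists_eq_mul.2
      ⟨_, hmin, Eventually.of_forall fun p ↦ hb p.1 p.2⟩
  refine (ho.neg_left).congr_left fun p ↦ ?_
  simp [gammaCross_eq_etaCov_add hd]

lemma gammaCross_self (i : Fin k) : gammaCross d q i i = gamma d q i := by
  ext t t'
  simp [gammaCross, gamma, pow_two, two_mul]

/-- The coefficient `q i * q j / (d i + d j)` is symmetric. When `t ≤ t'` the decay time is `d j`,
and exchanging the two sums turns it into `d i`; both cases then give the same sum, and the sum over
`j` is `ν i` times `γ i`. -/
lemma sum_gammaCross (hd : ∀ i, 0 < d i) (hq : ∀ i, q i ≠ 0) (t t' : ℝ≥0) :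
    ∑ i, ∑ j, gammaCross d q i j t t' = ∑ i, nu d q i * gamma d q i t t' := by
  have h : ∀ i, nu d q i * gamma d q i t t' =
      ∑ j, q i * q j / (d i + d j) * Real.exp (-|(t : ℝ) - t'| / d i) := fun i ↦ by
    rw [nu, Finset.sum_mul]
    refine Finset.sum_congr rfl fun j _ ↦ ?_
    have h1 := (hd i).ne'
    have h2 := hq i
    have h3 : d i + d j ≠ 0 := (add_pos (hd i) (hd j)).ne'
    rw [gamma]
    field_simp
  simp_rw [h, gammaCross]
  split_ifs with hle
  · rw [Finset.sum_comm]
    refine Finset.sum_congr rfl fun i _ ↦ Finset.sum_congr rfl fun j _ ↦ ?_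
    rw [mul_comm (q j), add_comm (d j)]
  · rfl

end Kernels

/-! ### Exponential convolution of an `L²` process -/

section ExpConv

/-- `∫_0^t z(s) e^{-(t-s)/δ} ds`. -/
noncomputable def expConv (δ : ℝ) (z : ℝ≥0 → ℝ) (t : ℝ≥0) : ℝ :=
  ∫ s in (0 : ℝ)..t, z s.toNNReal * Real.exp (-((t : ℝ) - s) / δ)

variable {Ω : Type*} [MeasurableSpace Ω] {P : Measure Ω} [IsProbabilityMeasure P]

/-- A jointly measurable square integrable process whose `L²` norm is locally integrable. -/
structure IsL2Process (P : Measure Ω) (Z : ℝ≥0 → Ω → ℝ) : Prop where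
  measurable : Measurable fun p : ℝ≥0 × Ω ↦ Z p.1 p.2
  memLp : ∀ t, MemLp (Z t) 2 P
  lintegral_ne_top : ∀ t : ℝ≥0,
    ∫⁻ s in Set.Ioc 0 (t : ℝ), eLpNorm (Z s.toNNReal) 2 P ≠ ∞

variable {Z : ℝ≥0 → Ω → ℝ} {δ : ℝ}

lemma expConv_eq (δ : ℝ) (z : ℝ≥0 → ℝ) (t : ℝ≥0) : expConv δ z t =
    ∫ s in Set.Ioc 0 (t : ℝ), z s.toNNReal * Real.exp (-((t : ℝ) - s) / δ) :=
  intervalIntegral.integral_of_le t.2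

namespace IsL2Process

lemma measurable_weighted (hZ : IsL2Process P Z) (δ : ℝ) (t : ℝ≥0) :
    Measurable (Function.uncurry fun (s : ℝ) ω ↦
      Z s.toNNReal ω * Real.exp (-((t : ℝ) - s) / δ)) := by
  refine Measurable.mul (hZ.measurable.comp
    (measurable_real_toNNReal.comp measurable_fst |>.prodMk measurable_snd)) ?_
  fun_prop

lemma memLp_weighted (hZ : IsL2Process P Z) (δ : ℝ) (t : ℝ≥0) (s : ℝ) :
    MemLp (fun ω ↦ Z s.toNNReal ω * Real.exp (-((t : ℝ) - s) / δ)) 2 P :=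
  (hZ.memLp _).mul_const _

lemma lintegral_weighted_ne_top (hZ : IsL2Process P Z) (hδ : 0 < δ) (t : ℝ≥0) :
    ∫⁻ s in Set.Ioc 0 (t : ℝ),
      eLpNorm (fun ω ↦ Z s.toNNReal ω * Real.exp (-((t : ℝ) - s) / δ)) 2 P ≠ ∞ := by
  refine ne_top_of_le_ne_top (hZ.lintegral_ne_top t) (lintegral_mono_ae ?_)
  filter_upwards [ae_restrict_mem measurableSet_Ioc] with s hs
  refine eLpNorm_mono fun ω ↦ ?_
  rw [norm_mul, Real.norm_eq_abs (Real.exp _), abs_of_pos (Real.exp_pos _)]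
  refine mul_le_of_le_one_right (norm_nonneg _) ?_
  rw [Real.exp_le_one_iff]
  exact div_nonpos_of_nonpos_of_nonneg (by linarith [hs.2]) hδ.le

lemma memLp_expConv (hZ : IsL2Process P Z) (hδ : 0 < δ) (t : ℝ≥0) :
    MemLp (fun ω ↦ expConv δ (fun s ↦ Z s ω) t) 2 P := by
  simp_rw [expConv_eq]
  exact memLp_integral_process (hZ.measurable_weighted δ t) (hZ.lintegral_weighted_ne_top hδ t)

lemma integral_expConv (hZ : IsL2Process P Z) (hδ : 0 < δ) (t : ℝ≥0) :
    ∫ ω, expConv δ (fun s ↦ Z s ω) t ∂P = expConv δ (fun s ↦ ∫ ω, Z s ω ∂P) t := by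
  simp_rw [expConv_eq]
  rw [integral_integral_process (hZ.measurable_weighted δ t) (hZ.lintegral_weighted_ne_top hδ t)]
  simp_rw [integral_mul_const]

lemma covariance_expConv_left (hZ : IsL2Process P Z) (hδ : 0 < δ) (t : ℝ≥0) {V : Ω → ℝ}
    (hV : MemLp V 2 P) :
    cov[fun ω ↦ expConv δ (fun s ↦ Z s ω) t, V; P] = expConv δ (fun s ↦ cov[Z s, V; P]) t := by
  simp_rw [expConv_eq]
  rw [covariance_integral_process_left (hZ.measurable_weighted δ t) (hZ.memLp_weighted δ t)
    (hZ.lintegral_weighted_ne_top hδ t) hV]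
  simp_rw [covariance_mul_const_left]

lemma covariance_expConv_right (hZ : IsL2Process P Z) (hδ : 0 < δ) (t : ℝ≥0) {V : Ω → ℝ}
    (hV : MemLp V 2 P) :
    cov[V, fun ω ↦ expConv δ (fun s ↦ Z s ω) t; P] = expConv δ (fun s ↦ cov[V, Z s; P]) t := by
  rw [covariance_comm, hZ.covariance_expConv_left hδ t hV]
  simp_rw [covariance_comm V]

lemma ae_intervalIntegrable (hZ : IsL2Process P Z) :
    ∀ᵐ ω ∂P, ∀ t : ℝ≥0, IntervalIntegrable (fun s : ℝ ↦ Z s.toNNReal ω) volume 0 t := by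
  have hm : Measurable (Function.uncurry fun (s : ℝ) ω ↦ Z s.toNNReal ω) :=
    hZ.measurable.comp (measurable_real_toNNReal.comp measurable_fst |>.prodMk measurable_snd)
  -- Integer end points suffice and produce a single null set valid for all `t`.
  have h : ∀ᵐ ω ∂P, ∀ n : ℕ, IntegrableOn (fun s : ℝ ↦ Z s.toNNReal ω)
      (Set.Ioc 0 ((n : ℝ≥0) : ℝ)) := by
    rw [ae_all_iff]
    exact fun n ↦ ae_integrable_process hm (hZ.lintegral_ne_top n)
  filter_upwards [h] with ω h t
  obtain ⟨n, hn⟩ := exists_nat_ge t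
  refine (intervalIntegrable_iff_integrableOn_Ioc_of_le (NNReal.coe_nonneg t)).2 ?_
  exact (h n).mono_set (Set.Ioc_subset_Ioc_right (by exact_mod_cast hn))

end IsL2Process

lemma eLpNorm_two_eq_ofReal_sqrt {f : Ω → ℝ} (hf : MemLp f 2 P) :
    eLpNorm f 2 P = ENNReal.ofReal √(∫ ω, f ω ^ 2 ∂P) := by
  rw [hf.eLpNorm_eq_integral_rpow_norm (by norm_num) (by norm_num), Real.sqrt_eq_rpow]
  simp

lemma eLpNorm_two_le_of_gaussian {f : Ω → ℝ} (hf : MemLp f 2 P) :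
    eLpNorm f 2 P ≤ ENNReal.ofReal (√(cov[f, f; P]) + |∫ ω, f ω ∂P|) := by
  rw [eLpNorm_two_eq_ofReal_sqrt hf]
  refine ENNReal.ofReal_le_ofReal ?_
  have h : ∫ ω, f ω ^ 2 ∂P = cov[f, f; P] + (∫ ω, f ω ∂P) ^ 2 := by
    rw [covariance_eq_sub hf hf]
    simp_rw [pow_two]
    simp
  have h0 : 0 ≤ cov[f, f; P] := by
    rw [covariance_self hf.aestronglyMeasurable.aemeasurable]
    exact variance_nonneg _ _
  rw [h]
  refine Real.sqrt_le_iff.2 ⟨by positivity, ?_⟩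
  have h1 := Real.sq_sqrt h0
  have h2 := sq_abs (∫ ω, f ω ∂P)
  have h3 : 0 ≤ √(cov[f, f; P]) * |∫ ω, f ω ∂P| := by positivity
  nlinarith

/-- The `L²` norm at time `s` is at most the standard deviation `√(K s s)` plus `|F s|`, and both
are locally integrable by hypothesis. -/
lemma IsL2Process.of_isGP {F : ℝ≥0 → ℝ} {K : ℝ≥0 → ℝ≥0 → ℝ} (hZ : IsGP P Z F K)
    (hm : Measurable fun p : ℝ≥0 × Ω ↦ Z p.1 p.2)
    (hF : ∀ t : ℝ≥0, IntervalIntegrable (fun s : ℝ ↦ F s.toNNReal) volume 0 t)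
    (hK : ∀ t : ℝ≥0, IntervalIntegrable (fun s : ℝ ↦ √(K s.toNNReal s.toNNReal)) volume 0 t) :
    IsL2Process P Z where
  measurable := hm
  memLp t := (hZ.gaussian.hasGaussianLaw_eval t).memLp_two
  lintegral_ne_top t := by
    have hint : IntegrableOn (fun s : ℝ ↦ √(K s.toNNReal s.toNNReal) + |F s.toNNReal|)
        (Set.Ioc 0 (t : ℝ)) :=
      (intervalIntegrable_iff_integrableOn_Ioc_of_le (NNReal.coe_nonneg t)).1
        ((hK t).add (hF t).abs)
    refine ne_top_of_le_ne_top hint.lintegral_lt_top.ne (lintegral_mono fun s ↦ ?_)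
    have h := eLpNorm_two_le_of_gaussian (hZ.gaussian.hasGaussianLaw_eval s.toNNReal).memLp_two
    rwa [hZ.cov, hZ.mean] at h

end ExpConv

/-! ### Solving the equation path by path -/

section Paths

/-- The right side integrates the derivative of `V s * e^{-(t-s)/δ}`. As `h` is only integrable, `V`
is merely absolutely continuous, so integration by parts is used in that generality. -/
lemma variation_of_constants {h V : ℝ → ℝ} {δ t : ℝ} (ht : 0 ≤ t)
    (hh : IntervalIntegrable h volume 0 t) (hV : ∀ s ∈ Set.Icc 0 t, V s = ∫ r in (0 : ℝ)..s, h r) :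
    V t = ∫ s in (0 : ℝ)..t, (h s + V s / δ) * Real.exp (-(t - s) / δ) := by
  set f : ℝ → ℝ := fun s ↦ Real.exp (-(t - s) / δ) with hf
  set g : ℝ → ℝ := fun s ↦ ∫ r in (0 : ℝ)..s, h r with hg
  have hfd : ∀ s, HasDerivAt f (f s / δ) s := fun s ↦ by
    have h1 : HasDerivAt (fun s ↦ -(t - s) / δ) (1 / δ) s := by
      simpa using (((hasDerivAt_id s).const_sub t).neg).div_const δ
    simpa [hf, div_eq_mul_inv] using h1.exp
  have hfc : ContDiff ℝ 1 f := by
    simp only [hf]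
    fun_prop
  have hfac : AbsolutelyContinuousOnInterval f 0 t := hfc.contDiffOn.absolutelyContinuousOnInterval
  have hgac : AbsolutelyContinuousOnInterval g 0 t :=
    hh.absolutelyContinuousOnInterval_intervalIntegral (by simp)
  have hp := hfac.integral_mul_deriv_eq_deriv_mul hgac
  have hg' : ∫ s in (0 : ℝ)..t, f s * deriv g s = ∫ s in (0 : ℝ)..t, f s * h s := by
    refine intervalIntegral.integral_congr_ae ?_
    filter_upwards [hh.ae_hasDerivAt_integral] with s hs hst
    rw [(hs (Set.uIoc_subset_uIcc hst) 0 (by simp)).deriv]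
  have hVg : ∀ s ∈ Set.uIcc 0 t, V s = g s := fun s hs ↦ hV s (by rwa [Set.uIcc_of_le ht] at hs)
  have hgc : ContinuousOn g (Set.uIcc 0 t) := hgac.continuousOn
  have hfcont : Continuous f := hfc.continuous
  rw [hg'] at hp
  have hft : f t = 1 := by simp [hf]
  have hg0 : g 0 = 0 := by simp [hg]
  rw [hft, hg0, mul_zero, sub_zero, one_mul] at hp
  have h1 : ∫ s in (0 : ℝ)..t, (h s + V s / δ) * f s =
      ∫ s in (0 : ℝ)..t, (f s * h s + deriv f s * g s) := by
    refine intervalIntegral.integral_congr fun s hs ↦ ?_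
    rw [hVg s hs, (hfd s).deriv]
    ring
  rw [h1, intervalIntegral.integral_add, hp, hVg t (by simp)]
  · ring
  · exact hh.continuousOn_mul hfcont.continuousOn
  · refine ContinuousOn.intervalIntegrable (ContinuousOn.mul ?_ hgc)
    have : deriv f = fun s ↦ f s / δ := funext fun s ↦ (hfd s).deriv
    rw [this]
    fun_prop

/-- `∫_0^t e^{-(t-s)/δ} dβ(s)`, defined through an integration by parts. -/
noncomputable def ornstein (δ : ℝ) (β : ℝ≥0 → ℝ) (t : ℝ≥0) : ℝ := β t - 1 / δ * expConv δ β t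

/-- Subtracting the noise leaves `V = S - σ (ρ/δ) β`, an integral with integrand `h = (ρ g - S)/δ`.
In `h + V/δ` the unknown `S` cancels, so variation of constants gives an explicit formula in which
`β` enters only through its value at `t` and its convolution. -/
lemma eq_expConv_add_ornstein {δ ρ σ : ℝ} {S g β : ℝ≥0 → ℝ}
    (hS : Continuous S) (hβ : Continuous β)
    (hg : ∀ t : ℝ≥0, IntervalIntegrable (fun s : ℝ ↦ g s.toNNReal) volume 0 t)
    (h : ∀ t : ℝ≥0, S t = (∫ s in (0 : ℝ)..t, 1 / δ * (ρ * g s.toNNReal - S s.toNNReal)) +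
      σ * (ρ / δ) * β t) (t : ℝ≥0) :
    S t = ρ / δ * expConv δ g t + σ * (ρ / δ * ornstein δ β t) := by
  have hSc : Continuous fun s : ℝ ↦ S s.toNNReal := hS.comp continuous_real_toNNReal
  have hβc : Continuous fun s : ℝ ↦ β s.toNNReal := hβ.comp continuous_real_toNNReal
  have hint : IntervalIntegrable (fun s : ℝ ↦ 1 / δ * (ρ * g s.toNNReal - S s.toNNReal))
      volume 0 t := (((hg t).const_mul ρ).sub (hSc.intervalIntegrable _ _)).const_mul _
  have hV := variation_of_constants (V := fun s : ℝ ↦ S s.toNNReal - σ * (ρ / δ) * β s.toNNReal)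
    (δ := δ) t.2 hint fun s hs ↦ by
      have := h s.toNNReal
      rw [Real.coe_toNNReal _ hs.1] at this
      rw [this]
      ring
  simp only [NNReal.val_eq_coe, Real.toNNReal_coe] at hV
  have hsplit : ∫ s in (0 : ℝ)..t, (1 / δ * (ρ * g s.toNNReal - S s.toNNReal) +
        (S s.toNNReal - σ * (ρ / δ) * β s.toNNReal) / δ) * Real.exp (-((t : ℝ) - s) / δ) =
      ρ / δ * expConv δ g t - σ * (ρ / δ) * (1 / δ) * expConv δ β t := by
    rw [expConv, expConv, ← intervalIntegral.integral_const_mul,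
      ← intervalIntegral.integral_const_mul, ← intervalIntegral.integral_sub]
    · refine intervalIntegral.integral_congr fun s _ ↦ ?_
      ring
    · exact ((hg t).mul_continuousOn (by fun_prop)).const_mul _
    · exact (Continuous.intervalIntegrable (by fun_prop) _ _)
  rw [hsplit] at hV
  rw [ornstein]
  linarith

lemma thermal_eq {Ω : Type*} [MeasurableSpace Ω] {P : Measure Ω} {k : ℕ}
    {A : Matrix (Fin k) (Fin k) ℝ} {b : Fin k → ℝ} {Φ : Matrix (Fin k) (Fin k) ℝ}
    {d q : Fin k → ℝ} (hΦ : IsDiagonalisation A b Φ d q) {σ : ℝ} {G B : ℝ≥0 → Ω → ℝ}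
    {X : ℝ≥0 → Ω → Fin k → ℝ} (hX : IsSolution P A b σ G B X)
    (hG : ∀ᵐ ω ∂P, ∀ t : ℝ≥0, IntervalIntegrable (fun s : ℝ ↦ G s.toNNReal ω) volume 0 t) :
    ∀ᵐ ω ∂P, ∀ i (t : ℝ≥0), thermal Φ X i t ω =
      (∫ s in (0 : ℝ)..t, 1 / d i * (q i * G s.toNNReal ω - thermal Φ X i s.toNNReal ω)) +
      σ * (q i / d i) * B t ω := by
  filter_upwards [hX.continuous, hX.eq, hG] with ω hc he hg i t
  have hXc : ∀ j, Continuous fun s : ℝ ↦ X s.toNNReal ω j := fun j ↦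
    (continuous_apply j).comp (hc.comp continuous_real_toNNReal)
  have hint : ∀ j, IntervalIntegrable
      (fun s : ℝ ↦ (A *ᵥ X s.toNNReal ω) j + b j * G s.toNNReal ω) volume 0 t := fun j ↦ by
    refine IntervalIntegrable.add (Continuous.intervalIntegrable ?_ _ _) ((hg t).const_mul _)
    simp only [Matrix.mulVec, dotProduct]
    fun_prop
  have h1 : thermal Φ X i t ω = ∑ j, Φ⁻¹ i j * X t ω j := rfl
  have h2 : ∑ j, Φ⁻¹ i j * b j = q i / d i := hΦ.forcing_eq i
  have h3 : ∀ s, ∑ j, Φ⁻¹ i j * (A *ᵥ X s ω) j = -1 / d i * thermal Φ X i s ω := fun s ↦ by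
    change (Φ⁻¹ *ᵥ (A *ᵥ X s ω)) i = _
    rw [Matrix.mulVec_mulVec, inv_mul_feedback hΦ, ← Matrix.mulVec_mulVec, Matrix.mulVec_diagonal]
    rfl
  rw [h1]
  simp_rw [he t]
  simp only [mul_add, Finset.sum_add_distrib]
  congr 1
  · simp_rw [← intervalIntegral.integral_const_mul]
    rw [← intervalIntegral.integral_finsetSum fun j _ ↦ (hint j).const_mul _]
    refine intervalIntegral.integral_congr fun s _ ↦ ?_
    simp only [mul_add, Finset.sum_add_distrib, h3, ← mul_assoc, ← Finset.sum_mul, h2]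
    ring
  · rw [← h2, Finset.mul_sum, Finset.sum_mul]
    exact Finset.sum_congr rfl fun j _ ↦ by ring

end Paths

/-! ### Covariances of the integrals against Brownian motion -/

section Brownian

variable {Ω : Type*} [MeasurableSpace Ω] {P : Measure Ω} [IsProbabilityMeasure P]
  {B : ℝ≥0 → Ω → ℝ}

/-- An almost surely continuous process is indistinguishable from a measurable process all of whose
paths are continuous. -/
lemma exists_continuous_measurable_eq (hB : ∀ t, AEMeasurable (B t) P)
    (hc : ∀ᵐ ω ∂P, Continuous fun t ↦ B t ω) :
    ∃ B' : ℝ≥0 → Ω → ℝ, (∀ ω, Continuous fun t ↦ B' t ω) ∧ (∀ t, Measurable (B' t)) ∧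
      ∀ᵐ ω ∂P, ∀ t, B t ω = B' t ω := by
  classical
  obtain ⟨D, hDc, hDd⟩ := TopologicalSpace.exists_countable_dense ℝ≥0
  have hae : ∀ᵐ ω ∂P, (Continuous fun t ↦ B t ω) ∧ ∀ t ∈ D, B t ω = (hB t).mk (B t) ω :=
    hc.and ((ae_ball_iff hDc).2 fun t _ ↦ (hB t).ae_eq_mk)
  -- The bad set need not be measurable, so it is enlarged to a measurable null set on which the new
  -- process is set to `0`. Off it, continuity recovers every time from a countable dense set where
  -- measurable versions agree with `B`.
  set Z := toMeasurable P {ω | ¬ ((Continuous fun t ↦ B t ω) ∧ ∀ t ∈ D, B t ω = (hB t).mk (B t) ω)}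
    with hZ
  have hZ0 : P Z = 0 := by rw [hZ, measure_toMeasurable]; exact hae
  have hZm : MeasurableSet Z := measurableSet_toMeasurable _ _
  have hgood : ∀ ω ∉ Z, (Continuous fun t ↦ B t ω) ∧ ∀ t ∈ D, B t ω = (hB t).mk (B t) ω :=
    fun ω hω ↦ by
      by_contra h
      exact hω (subset_toMeasurable _ _ h)
  refine ⟨fun t ↦ Zᶜ.indicator (B t), fun ω ↦ ?_, fun t ↦ ?_, ?_⟩
  · by_cases hω : ω ∈ Z
    · simp only [Set.indicator_of_notMem (Set.notMem_compl_iff.2 hω)]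
      exact continuous_const
    · simp only [Set.indicator_of_mem (Set.mem_compl hω)]
      exact (hgood ω hω).1
  · obtain ⟨u, hu, hut⟩ := mem_closure_iff_seq_limit.1 (hDd t)
    refine measurable_of_tendsto_metrizable
      (f := fun n ↦ Zᶜ.indicator ((hB (u n)).mk (B (u n))))
      (fun n ↦ (hB (u n)).measurable_mk.indicator hZm.compl) ?_
    rw [tendsto_pi_nhds]
    intro ω
    by_cases hω : ω ∈ Z
    · simp [hω]
    · simp only [Set.indicator_of_mem (Set.mem_compl hω)]
      simp_rw [← fun n ↦ (hgood ω hω).2 (u n) (hu n)]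
      exact ((hgood ω hω).1.tendsto t).comp hut
  · filter_upwards [measure_eq_zero_iff_ae_notMem.1 hZ0] with ω hω t
    rw [Set.indicator_of_mem (Set.mem_compl hω)]

lemma isGP_of_isPreBrownianReal (hB : IsPreBrownianReal B P) :
    IsGP P B (fun _ ↦ 0) (fun s t ↦ (min s t : ℝ≥0)) where
  gaussian := hB.isGaussianProcess
  mean t := hB.integral_eval t
  cov s t := by rw [hB.covariance_eval]

lemma isL2Process_of_isPreBrownianReal (hB : IsPreBrownianReal B P)
    (hc : ∀ ω, Continuous fun t ↦ B t ω) (hm : ∀ t, Measurable (B t)) : IsL2Process P B := by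
  refine .of_isGP (isGP_of_isPreBrownianReal hB) ?_ (fun t ↦ by simp) fun t ↦ ?_
  · exact measurable_uncurry_of_continuous_of_measurable hc hm
  · refine Continuous.intervalIntegrable ?_ _ _
    simp only [min_self]
    exact Real.continuous_sqrt.comp (NNReal.continuous_coe.comp continuous_real_toNNReal)

lemma memLp_ornstein (hB : IsL2Process P B) {δ : ℝ} (hδ : 0 < δ) (t : ℝ≥0) :
    MemLp (fun ω ↦ ornstein δ (fun s ↦ B s ω) t) 2 P :=
  (hB.memLp t).sub ((hB.memLp_expConv hδ t).const_mul _)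

lemma covariance_ornstein_left (hB : IsL2Process P B) {δ : ℝ} (hδ : 0 < δ) (t : ℝ≥0) {V : Ω → ℝ}
    (hV : MemLp V 2 P) :
    cov[fun ω ↦ ornstein δ (fun s ↦ B s ω) t, V; P] = ornstein δ (fun s ↦ cov[B s, V; P]) t := by
  simp only [ornstein]
  rw [covariance_fun_sub_left (hB.memLp t) ((hB.memLp_expConv hδ t).const_mul _) hV,
    covariance_const_mul_left, hB.covariance_expConv_left hδ t hV]

lemma expConv_congr {δ : ℝ} {z z' : ℝ≥0 → ℝ} {t : ℝ≥0} (h : ∀ s ≤ t, z s = z' s) :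
    expConv δ z t = expConv δ z' t := by
  refine intervalIntegral.integral_congr fun s hs ↦ ?_
  rw [Set.uIcc_of_le (NNReal.coe_nonneg t)] at hs
  rw [h s.toNNReal (Real.toNNReal_le_iff_le_coe.2 hs.2)]

lemma hasDerivAt_exp_sub_div (t δ s : ℝ) :
    HasDerivAt (fun s ↦ Real.exp (-(t - s) / δ)) (Real.exp (-(t - s) / δ) / δ) s := by
  have h1 : HasDerivAt (fun s ↦ -(t - s) / δ) (1 / δ) s := by
    simpa using (((hasDerivAt_id s).const_sub t).neg).div_const δ
  simpa [div_eq_mul_inv] using h1.exp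

/-- The integral is split at `u`, where `min s u` changes from `s` to `u`; each half has an explicit
primitive. -/
lemma expConv_min {δ : ℝ} (hδ : 0 < δ) {u t : ℝ≥0} (hut : u ≤ t) :
    expConv δ (fun s ↦ (min s u : ℝ≥0)) t =
      δ * (u - δ * (Real.exp (-((t : ℝ) - u) / δ) - Real.exp (-(t : ℝ) / δ))) := by
  have hut' : (u : ℝ) ≤ t := by exact_mod_cast hut
  have hδ' := hδ.ne'
  have h1 : ∫ s in (0 : ℝ)..u, ((min s.toNNReal u : ℝ≥0) : ℝ) * Real.exp (-((t : ℝ) - s) / δ) =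
      δ * (u - δ) * Real.exp (-((t : ℝ) - u) / δ) + δ ^ 2 * Real.exp (-(t : ℝ) / δ) := by
    have hd : ∀ s ∈ Set.uIcc (0 : ℝ) u, HasDerivAt
        (fun s ↦ δ * (s - δ) * Real.exp (-((t : ℝ) - s) / δ))
        (s * Real.exp (-((t : ℝ) - s) / δ)) s := fun s _ ↦ by
      refine ((((hasDerivAt_id s).sub_const δ).const_mul δ).fun_mul
        (hasDerivAt_exp_sub_div t δ s)).congr_deriv ?_
      simp only [id]
      field_simp
      ring
    have h := intervalIntegral.integral_eq_sub_of_hasDerivAt hd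
      (Continuous.intervalIntegrable (by fun_prop) _ _)
    rw [sub_zero] at h
    rw [intervalIntegral.integral_congr (g := fun s ↦ s * Real.exp (-((t : ℝ) - s) / δ)), h]
    · ring
    · intro s hs
      rw [Set.uIcc_of_le (NNReal.coe_nonneg u)] at hs
      simp only
      rw [min_eq_left (Real.toNNReal_le_iff_le_coe.2 hs.2), Real.coe_toNNReal _ hs.1]
  have h2 : ∫ s in (u : ℝ)..t, ((min s.toNNReal u : ℝ≥0) : ℝ) * Real.exp (-((t : ℝ) - s) / δ) =
      u * δ * (1 - Real.exp (-((t : ℝ) - u) / δ)) := by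
    have hd : ∀ s ∈ Set.uIcc (u : ℝ) t, HasDerivAt
        (fun s ↦ u * δ * Real.exp (-((t : ℝ) - s) / δ))
        (u * Real.exp (-((t : ℝ) - s) / δ)) s := fun s _ ↦ by
      refine ((hasDerivAt_exp_sub_div t δ s).const_mul ((u : ℝ) * δ)).congr_deriv ?_
      field_simp
    have h := intervalIntegral.integral_eq_sub_of_hasDerivAt hd
      (Continuous.intervalIntegrable (by fun_prop) _ _)
    rw [sub_self, neg_zero, zero_div, Real.exp_zero] at h
    rw [intervalIntegral.integral_congr (g := fun s ↦ u * Real.exp (-((t : ℝ) - s) / δ)), h]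
    · ring
    · intro s hs
      rw [Set.uIcc_of_le hut'] at hs
      simp only
      rw [min_eq_right (NNReal.le_toNNReal_of_coe_le hs.1)]
  have hcont : Continuous fun s : ℝ ↦
      ((min s.toNNReal u : ℝ≥0) : ℝ) * Real.exp (-((t : ℝ) - s) / δ) := by fun_prop
  rw [expConv, ← intervalIntegral.integral_add_adjacent_intervals
    (hcont.intervalIntegrable 0 u) (hcont.intervalIntegrable u t), h1, h2]
  ring

/-- The value is `∫₀ᵘ e^{-(t-s)/δ} ds`: the Itô isometry against the indicator of `(0, u]`, obtained
here by Fubini. -/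
lemma covariance_eval_ornstein (hB : IsPreBrownianReal B P) (hB2 : IsL2Process P B) {δ : ℝ}
    (hδ : 0 < δ) {u t : ℝ≥0} (hut : u ≤ t) :
    cov[B u, fun ω ↦ ornstein δ (fun s ↦ B s ω) t; P] =
      δ * (Real.exp (-((t : ℝ) - u) / δ) - Real.exp (-(t : ℝ) / δ)) := by
  rw [covariance_comm, covariance_ornstein_left hB2 hδ t (hB2.memLp u)]
  simp_rw [hB.covariance_eval]
  rw [ornstein, expConv_min hδ hut, min_eq_right hut]
  field_simp
  ring

lemma expConv_exp_sub {δ δ' : ℝ} (hδ : 0 < δ) (hδ' : 0 < δ') (t t' : ℝ≥0) :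
    expConv δ (fun s ↦ δ' * (Real.exp (-((t' : ℝ) - s) / δ') - Real.exp (-(t' : ℝ) / δ'))) t =
      δ * δ' ^ 2 / (δ + δ') * (Real.exp (-((t' : ℝ) - t) / δ') -
        Real.exp (-(t : ℝ) / δ) * Real.exp (-(t' : ℝ) / δ')) -
      δ * δ' * Real.exp (-(t' : ℝ) / δ') * (1 - Real.exp (-(t : ℝ) / δ)) := by
  have h1 := hδ.ne'
  have h2 := hδ'.ne'
  have h3 := (add_pos hδ hδ').ne'
  have hd : ∀ s ∈ Set.uIcc (0 : ℝ) t, HasDerivAt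
      (fun s ↦ δ * δ' ^ 2 / (δ + δ') *
          (Real.exp (-((t : ℝ) - s) / δ) * Real.exp (-((t' : ℝ) - s) / δ')) -
        δ * δ' * Real.exp (-(t' : ℝ) / δ') * Real.exp (-((t : ℝ) - s) / δ))
      (δ' * (Real.exp (-((t' : ℝ) - s) / δ') - Real.exp (-(t' : ℝ) / δ')) *
        Real.exp (-((t : ℝ) - s) / δ)) s := fun s _ ↦ by
    refine ((((hasDerivAt_exp_sub_div t δ s).fun_mul (hasDerivAt_exp_sub_div t' δ' s)).const_mul
      (δ * δ' ^ 2 / (δ + δ'))).fun_sub ((hasDerivAt_exp_sub_div t δ s).const_mul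
      (δ * δ' * Real.exp (-(t' : ℝ) / δ')))).congr_deriv ?_
    field_simp
    ring
  have h := intervalIntegral.integral_eq_sub_of_hasDerivAt hd
    (Continuous.intervalIntegrable (by fun_prop) _ _)
  rw [sub_self, neg_zero, zero_div, Real.exp_zero, sub_zero, sub_zero] at h
  rw [expConv, intervalIntegral.integral_congr (g := fun s : ℝ ↦
    δ' * (Real.exp (-((t' : ℝ) - s) / δ') - Real.exp (-(t' : ℝ) / δ')) *
      Real.exp (-((t : ℝ) - s) / δ)), h]
  · ring
  · intro s hs
    rw [Set.uIcc_of_le (NNReal.coe_nonneg t)] at hs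
    simp only [Real.coe_toNNReal _ hs.1]

/-- The value is `∫₀ᵗ e^{-(t-s)/δ} e^{-(t'-s)/δ'} ds`, the Itô isometry for two exponential weights.
The order `t ≤ t'` puts every time in the left convolution below `t'`, where
`covariance_eval_ornstein` applies. -/
lemma covariance_ornstein_ornstein (hB : IsPreBrownianReal B P) (hB2 : IsL2Process P B) {δ δ' : ℝ}
    (hδ : 0 < δ) (hδ' : 0 < δ') {t t' : ℝ≥0} (htt' : t ≤ t') :
    cov[fun ω ↦ ornstein δ (fun s ↦ B s ω) t, fun ω ↦ ornstein δ' (fun s ↦ B s ω) t'; P] =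
      δ * δ' / (δ + δ') * (Real.exp (-((t' : ℝ) - t) / δ') -
        Real.exp (-(t : ℝ) / δ) * Real.exp (-(t' : ℝ) / δ')) := by
  have h1 := hδ.ne'
  have h3 := (add_pos hδ hδ').ne'
  rw [covariance_ornstein_left hB2 hδ t (memLp_ornstein hB2 hδ' t'), ornstein,
    expConv_congr fun s hs ↦ covariance_eval_ornstein hB hB2 hδ' (hs.trans htt'),
    expConv_exp_sub hδ hδ', covariance_eval_ornstein hB hB2 hδ' htt']
  field_simp
  ring

lemma covariance_eta {k : ℕ} {d q : Fin k → ℝ} (hd : ∀ i, 0 < d i) (hB : IsPreBrownianReal B P)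
    (hB2 : IsL2Process P B) (i j : Fin k) (t t' : ℝ≥0) :
    cov[fun ω ↦ q i / d i * ornstein (d i) (fun s ↦ B s ω) t,
      fun ω ↦ q j / d j * ornstein (d j) (fun s ↦ B s ω) t'; P] = etaCov d q i j t t' := by
  wlog h : t ≤ t' generalizing i j t t'
  · rw [covariance_comm, this j i t' t (not_le.1 h).le, etaCov_comm]
  have h' : (t : ℝ) ≤ t' := by exact_mod_cast h
  have hi := (hd i).ne'
  have hj := (hd j).ne'
  have h3 := (add_pos (hd i) (hd j)).ne'
  rw [covariance_const_mul_left, covariance_const_mul_right,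
    covariance_ornstein_ornstein hB hB2 (hd i) (hd j) h, etaCov_of_le hd i j h,
    abs_of_nonpos (by linarith), ← Real.exp_add]
  have he : -(t : ℝ) / d i + -(t' : ℝ) / d j = -(d j * t + d i * t') / (d i * d j) := by
    field_simp
    ring
  have he' : -((t' : ℝ) - t) / d j = - -((t : ℝ) - t') / d j := by ring
  rw [he, he']
  field_simp

end Brownian

/-! ### Identification with the Wiener integral -/

section Wiener

/-- The cells are disjoint because the partition points are monotone, so only one term of the sum
survives: the cell ending at the first partition point that is at least `s`. -/
lemma Step.exists_eval_eq (φ : Step) {s : ℝ} (h0 : (φ.pt 0 : ℝ) < s) (hn : s ≤ φ.pt φ.n) :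
    ∃ l < φ.n, s ∈ Set.Ioc (φ.pt l : ℝ) (φ.pt (l + 1)) ∧ φ.eval s = φ.val l := by
  classical
  have hex : ∃ l, s ≤ φ.pt l := ⟨φ.n, hn⟩
  obtain ⟨l, hl⟩ : ∃ l, Nat.find hex = l + 1 := by
    refine Nat.exists_eq_succ_of_ne_zero fun h ↦ ?_
    have := Nat.find_spec hex
    rw [h] at this
    linarith
  have h1 : s ≤ φ.pt (l + 1) := hl ▸ Nat.find_spec hex
  have h2 : (φ.pt l : ℝ) < s := not_le.1 (Nat.find_min hex (by omega))
  have hln : l < φ.n := by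
    have := Nat.find_le (h := hex) hn
    omega
  refine ⟨l, hln, ⟨h2, h1⟩, ?_⟩
  rw [Step.eval, Finset.sum_eq_single l, Set.indicator_of_mem (Set.mem_Ioc.2 ⟨h2, h1⟩)]
  · intro m _ hm
    refine Set.indicator_of_notMem (fun hs ↦ ?_) _
    rcases lt_or_gt_of_ne hm with h | h
    · have : (φ.pt (m + 1) : ℝ) ≤ φ.pt l := by exact_mod_cast φ.mono (by omega)
      linarith [hs.2]
    · have : (φ.pt (l + 1) : ℝ) ≤ φ.pt m := by exact_mod_cast φ.mono (by omega)
      linarith [hs.1]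
  · intro h
    exact absurd (Finset.mem_range.2 hln) h

lemma abs_exp_sub_exp_le {δ t p s : ℝ} (hδ : 0 < δ) (hps : p ≤ s) (hst : s ≤ t) :
    |Real.exp (-(t - p) / δ) - Real.exp (-(t - s) / δ)| ≤ (s - p) / δ := by
  have h1 : Real.exp (-(t - p) / δ) = Real.exp (-(t - s) / δ) * Real.exp (-((s - p) / δ)) := by
    rw [← Real.exp_add]
    congr 1
    ring
  have h2 : Real.exp (-(t - s) / δ) ≤ 1 := by
    rw [Real.exp_le_one_iff]
    exact div_nonpos_of_nonpos_of_nonneg (by linarith) hδ.le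
  have h3 := Real.add_one_le_exp (-((s - p) / δ))
  have h4 : 0 ≤ (s - p) / δ := div_nonneg (by linarith) hδ.le
  have h5 : Real.exp (-((s - p) / δ)) ≤ 1 := by
    rw [Real.exp_le_one_iff]
    linarith
  have h6 := Real.exp_pos (-(t - s) / δ)
  rw [h1, abs_le]
  constructor <;> nlinarith

/-- Summation by parts for the elementary integral of an exponential weight. -/
lemma sum_exp_mul_sub_ornstein {δ : ℝ} {β : ℝ≥0 → ℝ} (hβ : Continuous β) (hβ0 : β 0 = 0)
    {p : ℕ → ℝ≥0} (hp0 : p 0 = 0) {n : ℕ} {t : ℝ≥0} (hpn : p n = t) :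
    ∑ l ∈ Finset.range n, Real.exp (-((t : ℝ) - p l) / δ) * (β (p (l + 1)) - β (p l)) -
        ornstein δ β t =
      ∑ l ∈ Finset.range n, ∫ s in (p l : ℝ)..p (l + 1),
        (β s.toNNReal - β (p (l + 1))) * (Real.exp (-((t : ℝ) - s) / δ) / δ) := by
  have hβc : Continuous fun s : ℝ ↦ β s.toNNReal := hβ.comp continuous_real_toNNReal
  -- Abel summation moves the increments from `β` to the weight, whose increments are integrals of
  -- its derivative. The boundary term at `0` vanishes because `β 0 = 0`.
  have habel : ∀ n, ∑ l ∈ Finset.range n,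
        Real.exp (-((t : ℝ) - p l) / δ) * (β (p (l + 1)) - β (p l)) =
      Real.exp (-((t : ℝ) - p n) / δ) * β (p n) - ∑ l ∈ Finset.range n, β (p (l + 1)) *
        (Real.exp (-((t : ℝ) - p (l + 1)) / δ) - Real.exp (-((t : ℝ) - p l) / δ)) := by
    intro n
    induction n with
    | zero => simp [hp0, hβ0]
    | succ n ih =>
      rw [Finset.sum_range_succ, ih, Finset.sum_range_succ]
      ring
  have hft : ∀ a b : ℝ, ∫ s in a..b, Real.exp (-((t : ℝ) - s) / δ) / δ =
      Real.exp (-((t : ℝ) - b) / δ) - Real.exp (-((t : ℝ) - a) / δ) := fun a b ↦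
    intervalIntegral.integral_eq_sub_of_hasDerivAt (fun s _ ↦ hasDerivAt_exp_sub_div t δ s)
      (Continuous.intervalIntegrable (by fun_prop) _ _)
  have hconv : 1 / δ * expConv δ β t = ∑ l ∈ Finset.range n, ∫ s in (p l : ℝ)..p (l + 1),
      β s.toNNReal * (Real.exp (-((t : ℝ) - s) / δ) / δ) := by
    rw [intervalIntegral.sum_integral_adjacent_intervals (a := fun l ↦ (p l : ℝ))
      fun l _ ↦ Continuous.intervalIntegrable (by fun_prop) _ _, hp0, hpn, expConv,
      ← intervalIntegral.integral_const_mul]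
    refine intervalIntegral.integral_congr fun s _ ↦ ?_
    ring
  have hterm : ∀ l, ∫ s in (p l : ℝ)..p (l + 1),
        (β s.toNNReal - β (p (l + 1))) * (Real.exp (-((t : ℝ) - s) / δ) / δ) =
      (∫ s in (p l : ℝ)..p (l + 1), β s.toNNReal * (Real.exp (-((t : ℝ) - s) / δ) / δ)) -
      β (p (l + 1)) * (Real.exp (-((t : ℝ) - p (l + 1)) / δ) - Real.exp (-((t : ℝ) - p l) / δ)) := by
    intro l
    rw [← hft, ← intervalIntegral.integral_const_mul, ← intervalIntegral.integral_sub]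
    · simp_rw [sub_mul]
    · exact Continuous.intervalIntegrable (by fun_prop) _ _
    · exact Continuous.intervalIntegrable (by fun_prop) _ _
  simp_rw [hterm]
  rw [Finset.sum_sub_distrib, ← hconv, habel n, ornstein, hpn]
  simp

variable {Ω : Type*} [MeasurableSpace Ω] {P : Measure Ω} [IsProbabilityMeasure P]
  {B : ℝ≥0 → Ω → ℝ}

lemma eLpNorm_sub_le (hB : IsPreBrownianReal B P) {s u : ℝ≥0} (hsu : s ≤ u) :
    eLpNorm (fun ω ↦ B s ω - B u ω) 2 P ≤ ENNReal.ofReal √((u : ℝ) - s) := by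
  have h2 : ∀ t, MemLp (B t) 2 P := fun t ↦ (hB.isGaussianProcess.hasGaussianLaw_eval t).memLp_two
  have h := eLpNorm_two_le_of_gaussian ((h2 s).sub (h2 u))
  rw [covariance_sub_sub (h2 s) (h2 u) (h2 s) (h2 u)] at h
  simp only [hB.covariance_eval, min_self, min_eq_left hsu, min_eq_right hsu, Pi.sub_apply] at h
  rw [integral_sub (hB.integrable_eval s) (hB.integrable_eval u), hB.integral_eval,
    hB.integral_eval] at h
  refine h.trans (le_of_eq ?_)
  rw [sub_zero, abs_zero, add_zero]
  congr 2
  ring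

/-- This is the error of one cell of the partition. By Minkowski it is the cell length times a bound
on the integrand, and `B s - B u` has `L²` norm `√(u - s) ≤ √(u - a)`. Over cells of length `t / (N
+ 1)` the errors add up to `t / δ * √(t / (N + 1))`, which tends to `0`. -/
lemma eLpNorm_integral_increment_le (hB : IsPreBrownianReal B P)
    (hc : ∀ ω, Continuous fun t ↦ B t ω) (hm : ∀ t, Measurable (B t)) {δ : ℝ} (hδ : 0 < δ)
    {a u t : ℝ≥0} (hau : a ≤ u) (hut : u ≤ t) :
    eLpNorm (fun ω ↦ ∫ s in (a : ℝ)..u,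
        (B s.toNNReal ω - B u ω) * (Real.exp (-((t : ℝ) - s) / δ) / δ)) 2 P ≤
      ENNReal.ofReal (√((u : ℝ) - a) / δ * (u - a)) := by
  have hau' : (a : ℝ) ≤ u := by exact_mod_cast hau
  have hut' : (u : ℝ) ≤ t := by exact_mod_cast hut
  have hmeas : Measurable (Function.uncurry fun (s : ℝ) ω ↦
      (B s.toNNReal ω - B u ω) * (Real.exp (-((t : ℝ) - s) / δ) / δ)) := by
    refine Measurable.mul (Measurable.sub ?_ ((hm u).comp measurable_snd)) (by fun_prop)
    exact (measurable_uncurry_of_continuous_of_measurable hc hm).comp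
      (measurable_real_toNNReal.comp measurable_fst |>.prodMk measurable_snd)
  have hbound : ∫⁻ s in Set.Ioc (a : ℝ) u, eLpNorm (fun ω ↦
      (B s.toNNReal ω - B u ω) * (Real.exp (-((t : ℝ) - s) / δ) / δ)) 2 P ≤
      ENNReal.ofReal (√((u : ℝ) - a) / δ * (u - a)) := by
    calc _ ≤ ∫⁻ _ in Set.Ioc (a : ℝ) u, ENNReal.ofReal (√((u : ℝ) - a) / δ) := by
          refine lintegral_mono_ae ?_
          filter_upwards [ae_restrict_mem measurableSet_Ioc] with s hs
          have hs0 : 0 ≤ s := a.2.trans hs.1.le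
          have hexp : Real.exp (-((t : ℝ) - s) / δ) ≤ 1 := by
            rw [Real.exp_le_one_iff]
            exact div_nonpos_of_nonpos_of_nonneg (by linarith [hs.2]) hδ.le
          have h1 : ∀ ω, ‖(B s.toNNReal ω - B u ω) * (Real.exp (-((t : ℝ) - s) / δ) / δ)‖ ≤
              ‖(1 / δ) • (B s.toNNReal ω - B u ω)‖ := fun ω ↦ by
            rw [norm_mul, norm_smul, mul_comm]
            refine mul_le_mul_of_nonneg_right ?_ (norm_nonneg _)
            rw [Real.norm_of_nonneg (by positivity), Real.norm_of_nonneg (by positivity)]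
            gcongr
          refine (eLpNorm_mono h1).trans ?_
          have h2 := eLpNorm_const_smul (1 / δ) (fun ω ↦ B s.toNNReal ω - B u ω) 2 P
          refine h2.le.trans ?_
          rw [show √((u : ℝ) - a) / δ = 1 / δ * √((u : ℝ) - a) by ring,
            ENNReal.ofReal_mul (by positivity), Real.enorm_eq_ofReal (by positivity)]
          gcongr
          refine (eLpNorm_sub_le hB (Real.toNNReal_le_iff_le_coe.2 hs.2)).trans ?_
          rw [Real.coe_toNNReal _ hs0]
          gcongr
          exact hs.1.le
      _ = _ := by
          rw [lintegral_const, Measure.restrict_apply_univ, Real.volume_Ioc,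
            ← ENNReal.ofReal_mul (by positivity)]
  simp_rw [intervalIntegral.integral_of_le hau']
  exact (eLpNorm_integral_process_le hmeas (ne_top_of_le_ne_top ENNReal.ofReal_ne_top hbound)).trans
    hbound

/-- The step function that samples the exponential weight on a uniform partition of `(0, t]`. -/
noncomputable def expStep (δ : ℝ) (t : ℝ≥0) (N : ℕ) : Step where
  -- With `N + 1` cells the mesh `t / (N + 1)` is meaningful for `N = 0` too. Sampling is at left
  -- end points.
  n := N + 1
  pt l := t * (l / (N + 1))
  mono l m h := by
    have : (l : ℝ≥0) ≤ m := by exact_mod_cast h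
    dsimp only
    gcongr
  val l := Real.exp (-((t : ℝ) - (t * (l / (N + 1)) : ℝ≥0)) / δ)

lemma expStep_pt_n (δ : ℝ) (t : ℝ≥0) (N : ℕ) : (expStep δ t N).pt (N + 1) = t := by
  simp [expStep]

lemma expStep_pt_sub (δ : ℝ) (t : ℝ≥0) (N l : ℕ) :
    ((expStep δ t N).pt (l + 1) : ℝ) - (expStep δ t N).pt l = t / (N + 1) := by
  simp only [expStep]
  push_cast
  ring

lemma tendsto_div_nat_add_one (x : ℝ) : Tendsto (fun N : ℕ ↦ x / (N + 1)) atTop (𝓝 0) := by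
  simpa [div_eq_mul_inv] using (tendsto_one_div_add_atTop_nhds_zero_nat (𝕜 := ℝ)).const_mul x

lemma tendsto_eLpNorm_expStep_eval {δ : ℝ} (hδ : 0 < δ) (t : ℝ≥0) :
    Tendsto (fun N ↦ eLpNorm (fun s ↦ (expStep δ t N).eval s - Real.exp (-((t : ℝ) - s) / δ)) 2
      (volume.restrict (Set.Ioc 0 (t : ℝ)))) atTop (𝓝 0) := by
  have hle : ∀ N, eLpNorm (fun s ↦ (expStep δ t N).eval s - Real.exp (-((t : ℝ) - s) / δ)) 2
      (volume.restrict (Set.Ioc 0 (t : ℝ))) ≤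
      (volume.restrict (Set.Ioc 0 (t : ℝ))) Set.univ ^ (2 : ℝ≥0∞).toReal⁻¹ *
        ENNReal.ofReal ((t / δ) / (N + 1)) := fun N ↦ by
    refine eLpNorm_le_of_ae_bound ?_
    filter_upwards [ae_restrict_mem measurableSet_Ioc] with s hs
    obtain ⟨l, hl, hls, hval⟩ := (expStep δ t N).exists_eval_eq (s := s)
      (by simpa [expStep] using hs.1) (by
        have := expStep_pt_n δ t N
        change s ≤ (expStep δ t N).pt (N + 1)
        rw [this]
        exact hs.2)
    rw [hval, Real.norm_eq_abs]
    refine (abs_exp_sub_exp_le hδ hls.1.le hs.2).trans ?_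
    have h := expStep_pt_sub δ t N l
    rw [div_right_comm]
    gcongr
    rw [← h]
    exact sub_le_sub_right hls.2 _
  refine tendsto_of_tendsto_of_tendsto_of_le_of_le tendsto_const_nhds ?_ (fun _ ↦ zero_le) hle
  have h := ENNReal.Tendsto.const_mul (a := (volume.restrict (Set.Ioc 0 (t : ℝ))) Set.univ ^
    (2 : ℝ≥0∞).toReal⁻¹) (ENNReal.tendsto_ofReal (tendsto_div_nat_add_one (t / δ)))
    (Or.inr (by simp))
  simpa using h

lemma tendsto_eLpNorm_expStep_integral (hB : IsPreBrownianReal B P)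
    (hc : ∀ ω, Continuous fun t ↦ B t ω) (hm : ∀ t, Measurable (B t)) {δ : ℝ} (hδ : 0 < δ)
    (t : ℝ≥0) :
    Tendsto (fun N ↦ eLpNorm (fun ω ↦ (expStep δ t N).integral B ω -
      ornstein δ (fun s ↦ B s ω) t) 2 P) atTop (𝓝 0) := by
  have hle : ∀ N, eLpNorm (fun ω ↦ (expStep δ t N).integral B ω -
      ornstein δ (fun s ↦ B s ω) t) 2 P ≤ ENNReal.ofReal (t / δ * √(t / (N + 1))) := fun N ↦ by
    set p := (expStep δ t N).pt with hp
    have hp0 : p 0 = 0 := by simp [hp, expStep]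
    have hpn : p (N + 1) = t := expStep_pt_n δ t N
    have hmono : Monotone p := (expStep δ t N).mono
    have hae : (fun ω ↦ (expStep δ t N).integral B ω - ornstein δ (fun s ↦ B s ω) t) =ᵐ[P]
        ∑ l ∈ Finset.range (N + 1), fun ω ↦ ∫ s in (p l : ℝ)..p (l + 1),
          (B s.toNNReal ω - B (p (l + 1)) ω) * (Real.exp (-((t : ℝ) - s) / δ) / δ) := by
      filter_upwards [hB.eval_zero_ae_eq_zero] with ω hω
      rw [Finset.sum_apply]
      exact sum_exp_mul_sub_ornstein (hc ω) hω hp0 hpn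
    have hmeas : ∀ l ∈ Finset.range (N + 1), AEStronglyMeasurable (fun ω ↦
        ∫ s in (p l : ℝ)..p (l + 1),
          (B s.toNNReal ω - B (p (l + 1)) ω) * (Real.exp (-((t : ℝ) - s) / δ) / δ)) P := by
      intro l _
      have hlu : (p l : ℝ) ≤ p (l + 1) := by exact_mod_cast hmono l.le_succ
      simp_rw [intervalIntegral.integral_of_le hlu]
      refine (StronglyMeasurable.integral_prod_left (f := fun (s : ℝ) ω ↦
        (B s.toNNReal ω - B (p (l + 1)) ω) * (Real.exp (-((t : ℝ) - s) / δ) / δ))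
        (Measurable.stronglyMeasurable ?_)).aestronglyMeasurable
      refine Measurable.mul (Measurable.sub ?_ ((hm _).comp measurable_snd)) (by fun_prop)
      exact (measurable_uncurry_of_continuous_of_measurable hc hm).comp
        (measurable_real_toNNReal.comp measurable_fst |>.prodMk measurable_snd)
    rw [eLpNorm_congr_ae hae]
    refine (eLpNorm_sum_le hmeas (by norm_num)).trans ?_
    have hterm : ∀ l ∈ Finset.range (N + 1), eLpNorm (fun ω ↦ ∫ s in (p l : ℝ)..p (l + 1),
          (B s.toNNReal ω - B (p (l + 1)) ω) * (Real.exp (-((t : ℝ) - s) / δ) / δ)) 2 P ≤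
        ENNReal.ofReal (√(t / (N + 1)) / δ * (t / (N + 1))) := fun l hl ↦ by
      have h := eLpNorm_integral_increment_le hB hc hm hδ (hmono l.le_succ)
        (t := t) (hpn ▸ hmono (Finset.mem_range.1 hl))
      rwa [Nat.succ_eq_add_one, expStep_pt_sub] at h
    refine (Finset.sum_le_sum hterm).trans (le_of_eq ?_)
    rw [Finset.sum_const, Finset.card_range, nsmul_eq_mul, ← ENNReal.ofReal_natCast,
      ← ENNReal.ofReal_mul (by positivity)]
    congr 1
    push_cast
    field_simp
  refine tendsto_of_tendsto_of_tendsto_of_le_of_le tendsto_const_nhds ?_ (fun _ ↦ zero_le) hle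
  have h := ENNReal.tendsto_ofReal ((((Real.continuous_sqrt.tendsto 0).comp
    (tendsto_div_nat_add_one t))).const_mul ((t : ℝ) / δ))
  simpa using h

lemma isWienerIntegral_ornstein (hB : IsPreBrownianReal B P)
    (hc : ∀ ω, Continuous fun t ↦ B t ω) (hm : ∀ t, Measurable (B t)) {δ : ℝ} (hδ : 0 < δ)
    (t : ℝ≥0) :
    IsWienerIntegral P B (fun s ↦ Real.exp (-((t : ℝ) - s) / δ)) t
      (fun ω ↦ ornstein δ (fun s ↦ B s ω) t) :=
  ⟨memLp_ornstein (isL2Process_of_isPreBrownianReal hB hc hm) hδ t, expStep δ t,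
    fun N ↦ (expStep_pt_n δ t N).le, tendsto_eLpNorm_expStep_eval hδ t,
    tendsto_eLpNorm_expStep_integral hB hc hm hδ t⟩

lemma IsWienerIntegral.congr {B' : ℝ≥0 → Ω → ℝ} {f : ℝ → ℝ} {t : ℝ≥0} {I : Ω → ℝ}
    (h : IsWienerIntegral P B f t I) (hBB' : ∀ᵐ ω ∂P, ∀ t, B' t ω = B t ω) :
    IsWienerIntegral P B' f t I := by
  obtain ⟨hI, φ, h1, h2, h3⟩ := h
  refine ⟨hI, φ, h1, h2, h3.congr fun N ↦ eLpNorm_congr_ae ?_⟩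
  filter_upwards [hBB'] with ω hω
  simp [Step.integral, hω]

end Wiener

/-! ### Joint Gaussianity, moments, and positivity of the memory kernel -/

section Assembly

variable {Ω : Type*} [MeasurableSpace Ω] {P : Measure Ω} [IsProbabilityMeasure P]

lemma covariance_congr_ae {X Y X' Y' : Ω → ℝ} (hX : X =ᵐ[P] X') (hY : Y =ᵐ[P] Y') :
    cov[X, Y; P] = cov[X', Y'; P] := by
  unfold covariance
  rw [integral_congr_ae hX, integral_congr_ae hY]
  refine integral_congr_ae ?_
  filter_upwards [hX, hY] with ω h h'
  rw [h, h']

lemma IsGP.congr {τ : Type*} {X Y : τ → Ω → ℝ} {m : τ → ℝ} {c : τ → τ → ℝ}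
    (hX : IsGP P X m c) (h : ∀ a, X a =ᵐ[P] Y a) : IsGP P Y m c where
  gaussian := hX.gaussian.congr h
  mean a := by rw [← integral_congr_ae (h a), hX.mean]
  cov a b := by rw [← covariance_congr_ae (h a) (h b), hX.cov]

lemma IsGP.comp {τ τ' : Type*} {X : τ → Ω → ℝ} {m : τ → ℝ} {c : τ → τ → ℝ}
    (hX : IsGP P X m c) (f : τ' → τ) :
    IsGP P (fun a ↦ X (f a)) (fun a ↦ m (f a)) (fun a b ↦ c (f a) (f b)) where
  gaussian := hX.gaussian.comp_right f
  mean a := hX.mean (f a)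
  cov a b := hX.cov (f a) (f b)

section ClosedSpan

variable {T : Type*} {W : T → Ω → ℝ}

/-- The random variable `f` belongs to the closed subspace of `L²` spanned by the family `W`. -/
def InClosedSpan (P : Measure Ω) (W : T → Ω → ℝ) (hW : ∀ t, MemLp (W t) 2 P) (f : Ω → ℝ) : Prop :=
  ∃ h : MemLp f 2 P, h.toLp f ∈ closedSpan W P hW

variable {hW : ∀ t, MemLp (W t) 2 P} {f g : Ω → ℝ}

lemma InClosedSpan.add (hf : InClosedSpan P W hW f) (hg : InClosedSpan P W hW g) :
    InClosedSpan P W hW fun ω ↦ f ω + g ω :=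
  ⟨hf.1.add hg.1, by
    have := Submodule.add_mem _ hf.2 hg.2
    rwa [← MemLp.toLp_add] at this⟩

lemma InClosedSpan.const_mul (hf : InClosedSpan P W hW f) (c : ℝ) :
    InClosedSpan P W hW fun ω ↦ c * f ω :=
  ⟨hf.1.const_mul c, by
    have := Submodule.smul_mem _ c hf.2
    rwa [← MemLp.toLp_const_smul] at this⟩

lemma InClosedSpan.sub (hf : InClosedSpan P W hW f) (hg : InClosedSpan P W hW g) :
    InClosedSpan P W hW fun ω ↦ f ω - g ω := by
  simpa [sub_eq_add_neg] using hf.add (hg.const_mul (-1))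

lemma InClosedSpan.sum {ι : Type*} (s : Finset ι) {f : ι → Ω → ℝ}
    (hf : ∀ i, InClosedSpan P W hW (f i)) : InClosedSpan P W hW fun ω ↦ ∑ i ∈ s, f i ω := by
  classical
  induction s using Finset.induction_on with
  | empty =>
    refine ⟨by simp, ?_⟩
    simp
  | insert i s hi ih =>
    simp_rw [Finset.sum_insert hi]
    exact (hf i).add ih

lemma inClosedSpan_expConv {Z : ℝ≥0 → Ω → ℝ} (hZ : IsL2Process P Z)
    (h : ∀ s, InClosedSpan P W hW (Z s)) {δ : ℝ} (hδ : 0 < δ) (t : ℝ≥0) :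
    InClosedSpan P W hW fun ω ↦ expConv δ (fun s ↦ Z s ω) t := by
  refine ⟨hZ.memLp_expConv hδ t, ?_⟩
  simp_rw [expConv_eq]
  refine toLp_integral_process_mem_closedSpan hW (hZ.measurable_weighted δ t)
    (hZ.memLp_weighted δ t) (hZ.lintegral_weighted_ne_top hδ t) fun s ↦ ?_
  have := (h s.toNNReal).const_mul (Real.exp (-((t : ℝ) - s) / δ))
  simp_rw [mul_comm (Real.exp _)] at this
  exact this.2

lemma isGaussianProcess_of_inClosedSpan {S : Type*} {Y : S → Ω → ℝ}
    (hG : IsGaussianProcess W P) (h : ∀ s, InClosedSpan P W hW (Y s)) : IsGaussianProcess Y P :=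
  isGaussianProcess_of_mem_closedSpan hG hW (fun s ↦ (h s).1) fun s ↦ (h s).2

end ClosedSpan

section Memory

variable {k : ℕ} {d q : Fin k → ℝ}

/-- The coefficient matrix is the limit of the equal-time matrices `etaCov d q i j T T`, hence
positive semidefinite. The exponentials factor over the two indices, so they are absorbed into the
test vector. -/
lemma posSemidef_memory (hd : ∀ i, 0 < d i)
    (h : ∀ T, (Matrix.of fun i j : Fin k ↦ etaCov d q i j T T).PosSemidef)
    {α : Type*} [Fintype α] (i : α → Fin k) (t : α → ℝ≥0) :
    (Matrix.of fun a b ↦ memory d q (i a) (i b) (t a) (t b)).PosSemidef := by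
  have hdiag : Tendsto (fun s : ℝ≥0 ↦ (s, s)) atTop (Filter.coprod atTop atTop) := by
    have h : Tendsto (fun s : ℝ≥0 ↦ (s, s)) atTop (comap Prod.fst atTop) :=
      tendsto_comap_iff.2 tendsto_id
    exact h.mono_right le_sup_left
  have hM : (Matrix.of fun i j : Fin k ↦ q i * q j / (d i + d j)).PosSemidef := by
    refine posSemidef_of_tendsto (l := (atTop : Filter ℝ≥0)) h fun i j ↦ ?_
    have h1 := ((tendsto_memory (q := q) hd i j).comp hdiag).const_sub (q i * q j / (d i + d j))
    rw [sub_zero] at h1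
    refine h1.congr fun T ↦ ?_
    have h2 := gammaCross_eq_etaCov_add (q := q) hd i j T T
    have h3 : gammaCross d q i j T T = q i * q j / (d i + d j) := by simp [gammaCross]
    simp only [Function.comp]
    linarith
  have hS := posSemidef_of_iff.1 (hM.submatrix i)
  refine posSemidef_of_iff.2 ⟨fun a b ↦ ?_, fun x ↦ ?_⟩
  · rw [memory, memory, mul_comm (q (i a)), add_comm (d (i a)), mul_comm (Real.exp _)]
  · refine (hS.2 fun a ↦ x a * Real.exp (-(t a : ℝ) / d (i a))).trans_eq ?_
    refine Finset.sum_congr rfl fun a _ ↦ Finset.sum_congr rfl fun b _ ↦ ?_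
    simp only [memory, Matrix.of_apply]
    ring

/-- The memory kernel on the index set `α × Fin k` is tested on vectors that do not depend on the
box. -/
lemma posSemidef_sum_memory (hd : ∀ i, 0 < d i)
    (h : ∀ T, (Matrix.of fun i j : Fin k ↦ etaCov d q i j T T).PosSemidef)
    {α : Type*} [Fintype α] (t : α → ℝ≥0) :
    (Matrix.of fun a b ↦ ∑ i, ∑ j, memory d q i j (t a) (t b)).PosSemidef := by
  have hS := posSemidef_of_iff.1 (posSemidef_memory hd h (fun p : α × Fin k ↦ p.2) fun p ↦ t p.1)
  refine posSemidef_of_iff.2 ⟨fun a b ↦ ?_, fun x ↦ ?_⟩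
  · rw [Finset.sum_comm]
    exact Finset.sum_congr rfl fun i _ ↦ Finset.sum_congr rfl fun j _ ↦ hS.1 (a, j) (b, i)
  · refine (hS.2 fun p ↦ x p.1).trans_eq ?_
    simp_rw [Fintype.sum_prod_type, Finset.mul_sum]
    exact Finset.sum_congr rfl fun a _ ↦ Finset.sum_comm

end Memory

section Responses

variable {k : ℕ} {d q : Fin k → ℝ} {G : ℝ≥0 → Ω → ℝ} {F : ℝ≥0 → ℝ} {K : ℝ≥0 → ℝ≥0 → ℝ}
  {B : ℝ≥0 → Ω → ℝ}

lemma response_eq (f : ℝ≥0 → ℝ) (i : Fin k) (t : ℝ≥0) :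
    response d q f i t = q i / d i * expConv (d i) f t := rfl

lemma integral_response (hG : IsGP P G F K) (hG2 : IsL2Process P G) (hd : ∀ i, 0 < d i) (i : Fin k)
    (t : ℝ≥0) : ∫ ω, response d q (fun s ↦ G s ω) i t ∂P = response d q F i t := by
  simp_rw [response_eq]
  rw [integral_const_mul, hG2.integral_expConv (hd i)]
  simp_rw [hG.mean]

lemma covariance_response (hG : IsGP P G F K) (hG2 : IsL2Process P G) (hd : ∀ i, 0 < d i)
    (i j : Fin k) (t t' : ℝ≥0) :
    cov[fun ω ↦ response d q (fun s ↦ G s ω) i t, fun ω ↦ response d q (fun s ↦ G s ω) j t'; P] =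
      kCross d q K i j t t' := by
  simp_rw [response_eq]
  rw [covariance_const_mul_left, covariance_const_mul_right,
    hG2.covariance_expConv_left (hd i) t (hG2.memLp_expConv (hd j) t')]
  simp_rw [fun s ↦ hG2.covariance_expConv_right (hd j) t' (hG2.memLp s), hG.cov]
  rw [kCross, ← mul_assoc, div_mul_div_comm]
  congr 1
  refine intervalIntegral.integral_congr fun s _ ↦ ?_
  simp only [expConv]
  rw [← intervalIntegral.integral_mul_const]
  refine intervalIntegral.integral_congr fun s' _ ↦ ?_
  ring

lemma covariance_response_eta (hG2 : IsL2Process P G) (hB2 : IsL2Process P B) (hd : ∀ i, 0 < d i)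
    (h : ∀ s u, cov[G s, B u; P] = 0) (i j : Fin k) (t t' : ℝ≥0) :
    cov[fun ω ↦ response d q (fun s ↦ G s ω) i t,
      fun ω ↦ q j / d j * ornstein (d j) (fun s ↦ B s ω) t'; P] = 0 := by
  have h1 : ∀ s, cov[G s, fun ω ↦ ornstein (d j) (fun s ↦ B s ω) t'; P] = 0 := fun s ↦ by
    rw [covariance_comm, covariance_ornstein_left hB2 (hd j) t' (hG2.memLp s)]
    simp_rw [fun u ↦ (covariance_comm (B u) (G s)).trans (h s u)]
    simp [ornstein, expConv]
  simp_rw [response_eq]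
  rw [covariance_const_mul_left, covariance_const_mul_right,
    hG2.covariance_expConv_left (hd i) t (memLp_ornstein hB2 (hd j) t')]
  simp_rw [h1]
  simp [expConv]

lemma integral_ornstein (hB : IsPreBrownianReal B P) (hB2 : IsL2Process P B) {δ : ℝ} (hδ : 0 < δ)
    (t : ℝ≥0) : ∫ ω, ornstein δ (fun s ↦ B s ω) t ∂P = 0 := by
  simp only [ornstein]
  rw [integral_sub (hB.integrable_eval t)
    (((hB2.memLp_expConv hδ t).integrable (by norm_num)).const_mul _), integral_const_mul,
    hB2.integral_expConv hδ]
  simp_rw [hB.integral_eval]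
  simp [expConv]

end Responses

lemma covariance_add_const_mul {f g f' g' : Ω → ℝ} (hf : MemLp f 2 P) (hg : MemLp g 2 P)
    (hf' : MemLp f' 2 P) (hg' : MemLp g' 2 P) (σ : ℝ) :
    cov[fun ω ↦ f ω + σ * g ω, fun ω ↦ f' ω + σ * g' ω; P] =
      cov[f, f'; P] + σ * cov[f, g'; P] + σ * cov[g, f'; P] + σ ^ 2 * cov[g, g'; P] := by
  have h := covariance_add_left hf (hg.const_mul σ) (hf'.add (hg'.const_mul σ))
  rw [covariance_add_right hf hf' (hg'.const_mul σ),
    covariance_add_right (hg.const_mul σ) hf' (hg'.const_mul σ), covariance_const_mul_left,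
    covariance_const_mul_left, covariance_const_mul_right, covariance_const_mul_right] at h
  refine h.trans ?_
  ring

end Assembly

end BoxModel

/-! ### The main theorem -/

theorem mainTheorem2
    {Ω : Type*} [MeasurableSpace Ω] (P : Measure Ω) [IsProbabilityMeasure P]
    -- the box model
    (k : ℕ) (hk : 0 < k) (C κ : Fin k → ℝ) (ε σ : ℝ)
    (hC : ∀ i, 0 < C i) (hκ : ∀ i, 0 < κ i) (hε : 0 < ε) (hσ : 0 < σ)
    -- its diagonalisation
    (Φ : Matrix (Fin k) (Fin k) ℝ) (d q : Fin k → ℝ)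
    (hΦ : BoxModel.IsDiagonalisation (BoxModel.feedback C κ ε) (BoxModel.forcingVec C) Φ d q)
    -- the forcing `G ∼ GP(F, K)`, with random paths `G`
    (G : ℝ≥0 → Ω → ℝ) (F : ℝ≥0 → ℝ) (K : ℝ≥0 → ℝ≥0 → ℝ)
    (hG : BoxModel.IsGP P G F K)
    (hG_meas : Measurable fun p : ℝ≥0 × Ω ↦ G p.1 p.2)
    (hF_int : ∀ t : ℝ≥0, IntervalIntegrable (fun s : ℝ ↦ F s.toNNReal) volume 0 t)
    (hK_int : ∀ t : ℝ≥0,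
      IntervalIntegrable (fun s : ℝ ↦ √(K s.toNNReal s.toNNReal)) volume 0 t)
    -- the Brownian motion, independent of the forcing
    (B : ℝ≥0 → Ω → ℝ) (hB : IsBrownianReal B P)
    (h_indep : IndepFun (fun ω t ↦ G t ω) (fun ω t ↦ B t ω) P)
    -- the box temperatures
    (X : ℝ≥0 → Ω → Fin k → ℝ)
    (hX : BoxModel.IsSolution P (BoxModel.feedback C κ ε) (BoxModel.forcingVec C) σ G B X) :
    (∀ i, 0 < d i ∧ q i ≠ 0) ∧
    -- `T = ∑ᵢ Sᵢ` is the temperature of the uppermost box if the first row of `Φ` consists of ones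
    ((∀ j, Φ ⟨0, hk⟩ j = 1) → ∀ t ω, X t ω ⟨0, hk⟩ = BoxModel.temperature Φ X t ω) ∧
    -- the impulse response system
    (∀ᵐ ω ∂P, ∀ i (t : ℝ≥0), BoxModel.thermal Φ X i t ω =
      (∫ s in (0 : ℝ)..t,
        1 / d i * (q i * G s.toNNReal ω - BoxModel.thermal Φ X i s.toNNReal ω)) +
      σ * (q i / d i) * B t ω) ∧
    -- the response to the forcing
    BoxModel.IsGP P
      (fun (p : Fin k × ℝ≥0) ω ↦ BoxModel.response d q (fun s ↦ G s ω) p.1 p.2)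
      (fun p ↦ BoxModel.response d q F p.1 p.2)
      (fun p p' ↦ BoxModel.kCross d q K p.1 p'.1 p.2 p'.2) ∧
    -- the internal variability
    (∃ η : Fin k → ℝ≥0 → Ω → ℝ,
      (∀ i (t : ℝ≥0), ∃ I : Ω → ℝ,
        BoxModel.IsWienerIntegral P B (fun s ↦ Real.exp (-((t : ℝ) - s) / d i)) t I ∧
        ∀ᵐ ω ∂P, η i t ω = q i / d i * I ω) ∧
      (∀ᵐ ω ∂P, ∀ i (t : ℝ≥0), BoxModel.thermal Φ X i t ω =
        BoxModel.response d q (fun s ↦ G s ω) i t + σ * η i t ω) ∧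
      IndepFun
        (fun ω (p : Fin k × ℝ≥0) ↦ BoxModel.response d q (fun s ↦ G s ω) p.1 p.2)
        (fun ω (p : Fin k × ℝ≥0) ↦ η p.1 p.2 ω) P ∧
      BoxModel.IsGP P (fun (p : Fin k × ℝ≥0) ↦ η p.1 p.2) (fun _ ↦ 0)
        (fun p p' ↦ BoxModel.etaCov d q p.1 p'.1 p.2 p'.2) ∧
      BoxModel.IsLongTimeGP P η (fun _ _ ↦ 0) (BoxModel.gammaCross d q)) ∧
    -- the exact covariance by cases, and its comparison with `γ_ij`
    (∀ i j (t t' : ℝ≥0), t ≤ t' → BoxModel.etaCov d q i j t t' =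
      q i * q j / (d i + d j) * (Real.exp (-|(t : ℝ) - t'| / d j) -
        Real.exp (-(d j * t + d i * t') / (d i * d j)))) ∧
    (∀ i j (t t' : ℝ≥0), t' ≤ t → BoxModel.etaCov d q i j t t' =
      q i * q j / (d i + d j) * (Real.exp (-|(t : ℝ) - t'| / d i) -
        Real.exp (-(d j * t + d i * t') / (d i * d j)))) ∧
    (∀ i j, Asymptotics.IsEquivalent (atTop : Filter (ℝ≥0 × ℝ≥0))
      (fun p ↦ BoxModel.etaCov d q i j p.1 p.2)
      (fun p ↦ BoxModel.gammaCross d q i j p.1 p.2)) ∧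
    (∀ i, BoxModel.gammaCross d q i i = BoxModel.gamma d q i) ∧
    -- the thermal responses
    BoxModel.IsGP P
      (fun (p : Fin k × ℝ≥0) ↦ BoxModel.thermal Φ X p.1 p.2)
      (fun p ↦ BoxModel.response d q F p.1 p.2)
      (fun p p' ↦ BoxModel.kCross d q K p.1 p'.1 p.2 p'.2 +
        σ ^ 2 * BoxModel.etaCov d q p.1 p'.1 p.2 p'.2) ∧
    BoxModel.IsLongTimeGP P (BoxModel.thermal Φ X) (BoxModel.response d q F)
      (fun i j t t' ↦ BoxModel.kCross d q K i j t t' +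
        σ ^ 2 * BoxModel.gammaCross d q i j t t') ∧
    -- the temperature
    BoxModel.IsGP P (BoxModel.temperature Φ X)
      (fun t ↦ ∑ i, BoxModel.response d q F i t)
      (fun t t' ↦ (∑ i, ∑ j, BoxModel.kCross d q K i j t t') +
        σ ^ 2 * ∑ i, ∑ j, BoxModel.etaCov d q i j t t') ∧
    (∀ t t', ∑ i, ∑ j, BoxModel.gammaCross d q i j t t' =
      ∑ i, BoxModel.nu d q i * BoxModel.gamma d q i t t') ∧
    BoxModel.IsLongTimeGP P (fun _ : Unit ↦ BoxModel.temperature Φ X)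
      (fun _ t ↦ ∑ i, BoxModel.response d q F i t)
      (fun _ _ t t' ↦ (∑ i, ∑ j, BoxModel.kCross d q K i j t t') +
        σ ^ 2 * ∑ i, BoxModel.nu d q i * BoxModel.gamma d q i t t') := by
  classical
  have hdq := BoxModel.pos_and_ne_zero_of_isDiagonalisation hC hκ hε hΦ
  have hd : ∀ i, 0 < d i := fun i ↦ (hdq i).1
  have hq : ∀ i, q i ≠ 0 := fun i ↦ (hdq i).2
  have hG2 := BoxModel.IsL2Process.of_isGP hG hG_meas hF_int hK_int
  -- `B` is only almost surely continuous and only almost everywhere measurable at each time; the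
  -- path integrals are formed with an indistinguishable version that is jointly measurable.
  obtain ⟨B', hc, hm, hBB'⟩ := BoxModel.exists_continuous_measurable_eq hB.aemeasurable hB.cont
  have hB' : IsPreBrownianReal B' P := hB.toIsPreBrownianReal.congr fun t ↦ by
    filter_upwards [hBB'] with ω h using h t
  have hB2 := BoxModel.isL2Process_of_isPreBrownianReal hB' hc hm
  -- the joint Gaussian process of the forcing and the Brownian motion
  have hW : IsGaussianProcess (Sum.elim G B') P := by
    refine (BoxModel.isGaussianProcess_sumElim hG.gaussian hB.isGaussianProcess h_indep).congr ?_
    rintro (s | t)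
    · exact ae_eq_refl _
    · filter_upwards [hBB'] with ω h using h t
  have hW2 : ∀ a, MemLp (Sum.elim G B' a) 2 P := fun a ↦ (hW.hasGaussianLaw_eval a).memLp_two
  have hcov0 : ∀ s u, cov[G s, B' u; P] = 0 := fun s u ↦ by
    have h : B u =ᵐ[P] B' u := by filter_upwards [hBB'] with ω h using h u
    rw [← BoxModel.covariance_congr_ae (ae_eq_refl _) h]
    have hi : IndepFun (G s) (B u) P :=
      h_indep.comp (φ := fun f : ℝ≥0 → ℝ ↦ f s) (ψ := fun f : ℝ≥0 → ℝ ↦ f u)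
        (measurable_pi_apply s) (measurable_pi_apply u)
    exact hi.covariance_eq_zero (hG2.memLp s) ((hB2.memLp u).ae_eq h.symm)
  set R : Fin k → ℝ≥0 → Ω → ℝ := fun i t ω ↦ BoxModel.response d q (fun s ↦ G s ω) i t with hR
  set η : Fin k → ℝ≥0 → Ω → ℝ := fun i t ω ↦
    q i / d i * BoxModel.ornstein (d i) (fun s ↦ B' s ω) t with hη
  have hGmem : ∀ s, BoxModel.InClosedSpan P (Sum.elim G B') hW2 (G s) := fun s ↦
    ⟨hG2.memLp s, BoxModel.toLp_mem_closedSpan hW2 (Sum.inl s)⟩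
  have hBmem : ∀ s, BoxModel.InClosedSpan P (Sum.elim G B') hW2 (B' s) := fun s ↦
    ⟨hB2.memLp s, BoxModel.toLp_mem_closedSpan hW2 (Sum.inr s)⟩
  have hRmem : ∀ i t, BoxModel.InClosedSpan P (Sum.elim G B') hW2 (R i t) := fun i t ↦
    (BoxModel.inClosedSpan_expConv hG2 hGmem (hd i) t).const_mul _
  have hηmem : ∀ i t, BoxModel.InClosedSpan P (Sum.elim G B') hW2 (η i t) := fun i t ↦
    ((hBmem t).sub ((BoxModel.inClosedSpan_expConv hB2 hBmem (hd i) t).const_mul _)).const_mul _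
  have hSmem : ∀ i t, BoxModel.InClosedSpan P (Sum.elim G B') hW2
      (fun ω ↦ R i t ω + σ * η i t ω) := fun i t ↦ (hRmem i t).add ((hηmem i t).const_mul σ)
  have hRmean : ∀ i t, ∫ ω, R i t ω ∂P = BoxModel.response d q F i t :=
    BoxModel.integral_response hG hG2 hd
  have hηmean : ∀ i t, ∫ ω, η i t ω ∂P = 0 := fun i t ↦ by
    simp only [hη]
    rw [integral_const_mul, BoxModel.integral_ornstein hB' hB2 (hd i), mul_zero]
  have hRcov : ∀ i j t t', cov[R i t, R j t'; P] = BoxModel.kCross d q K i j t t' :=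
    BoxModel.covariance_response hG hG2 hd
  have hηcov : ∀ i j t t', cov[η i t, η j t'; P] = BoxModel.etaCov d q i j t t' :=
    BoxModel.covariance_eta hd hB' hB2
  have hRη : ∀ i j t t', cov[R i t, η j t'; P] = 0 :=
    BoxModel.covariance_response_eta hG2 hB2 hd hcov0
  have hSmean : ∀ i t, ∫ ω, (R i t ω + σ * η i t ω) ∂P = BoxModel.response d q F i t := by
    intro i t
    -- The noise part is centred, so the mean is that of the response to the forcing.
    rw [integral_add ((hRmem i t).1.integrable (by norm_num))
      (((hηmem i t).1.integrable (by norm_num)).const_mul _), integral_const_mul, hRmean, hηmean,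
      mul_zero, add_zero]
  have hScov : ∀ i j t t',
      cov[fun ω ↦ R i t ω + σ * η i t ω, fun ω ↦ R j t' ω + σ * η j t' ω; P] =
        BoxModel.kCross d q K i j t t' + σ ^ 2 * BoxModel.etaCov d q i j t t' := by
    intro i j t t'
    rw [BoxModel.covariance_add_const_mul (hRmem i t).1 (hηmem i t).1 (hRmem j t').1
      (hηmem j t').1, hRcov, hηcov, hRη, covariance_comm (η i t), hRη]
    ring
  -- the dynamics
  have hpaths := hG2.ae_intervalIntegrable
  have hthermal := BoxModel.thermal_eq hΦ hX hpaths
  have hsol : ∀ᵐ ω ∂P, ∀ i (t : ℝ≥0), BoxModel.thermal Φ X i t ω = R i t ω + σ * η i t ω := by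
    filter_upwards [hthermal, hpaths, hX.continuous, hBB'] with ω h1 h2 h3 h4 i t
    have hSc : Continuous fun t ↦ BoxModel.thermal Φ X i t ω := by
      have : ∀ j, Continuous fun t ↦ X t ω j := fun j ↦ (continuous_apply j).comp h3
      simp only [BoxModel.thermal, Matrix.mulVec, dotProduct]
      fun_prop
    exact BoxModel.eq_expConv_add_ornstein (δ := d i) (ρ := q i) (σ := σ)
      (g := fun s ↦ G s ω) hSc (hc ω) h2 (fun t ↦ by rw [h1 i t, h4 t]) t
  -- Gaussian processes
  have hGPη : BoxModel.IsGP P (fun p : Fin k × ℝ≥0 ↦ η p.1 p.2) (fun _ ↦ 0)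
      (fun p p' ↦ BoxModel.etaCov d q p.1 p'.1 p.2 p'.2) :=
    ⟨BoxModel.isGaussianProcess_of_inClosedSpan hW fun p ↦ hηmem p.1 p.2,
      fun p ↦ hηmean p.1 p.2, fun p p' ↦ hηcov p.1 p'.1 p.2 p'.2⟩
  have hGPS : BoxModel.IsGP P (fun p : Fin k × ℝ≥0 ↦ BoxModel.thermal Φ X p.1 p.2)
      (fun p ↦ BoxModel.response d q F p.1 p.2)
      (fun p p' ↦ BoxModel.kCross d q K p.1 p'.1 p.2 p'.2 +
        σ ^ 2 * BoxModel.etaCov d q p.1 p'.1 p.2 p'.2) := by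
    refine BoxModel.IsGP.congr (X := fun p : Fin k × ℝ≥0 ↦ fun ω ↦ R p.1 p.2 ω + σ * η p.1 p.2 ω)
      ⟨BoxModel.isGaussianProcess_of_inClosedSpan hW fun p ↦ hSmem p.1 p.2,
        fun p ↦ hSmean p.1 p.2, fun p p' ↦ hScov p.1 p'.1 p.2 p'.2⟩ fun p ↦ ?_
    filter_upwards [hsol] with ω h using (h p.1 p.2).symm
  have hGPT : BoxModel.IsGP P (BoxModel.temperature Φ X)
      (fun t ↦ ∑ i, BoxModel.response d q F i t)
      (fun t t' ↦ (∑ i, ∑ j, BoxModel.kCross d q K i j t t') +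
        σ ^ 2 * ∑ i, ∑ j, BoxModel.etaCov d q i j t t') := by
    refine BoxModel.IsGP.congr (X := fun t ω ↦ ∑ i, (R i t ω + σ * η i t ω))
      ⟨BoxModel.isGaussianProcess_of_inClosedSpan hW fun t ↦
        BoxModel.InClosedSpan.sum Finset.univ fun i ↦ hSmem i t, fun t ↦ ?_, fun t t' ↦ ?_⟩
      fun t ↦ ?_
    · rw [integral_finsetSum _ fun i _ ↦ (hSmem i t).1.integrable (by norm_num)]
      exact Finset.sum_congr rfl fun i _ ↦ hSmean i t
    · rw [covariance_fun_sum_fun_sum (fun i ↦ (hSmem i t).1) fun j ↦ (hSmem j t').1]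
      simp_rw [hScov, Finset.sum_add_distrib, Finset.mul_sum]
    · filter_upwards [hsol] with ω h
      exact Finset.sum_congr rfl fun i _ ↦ (h i t).symm
  -- the long time regime
  have hPSD : ∀ T, (Matrix.of fun i j : Fin k ↦ BoxModel.etaCov d q i j T T).PosSemidef := by
    intro T
    have h := BoxModel.posSemidef_covariance (P := P) (X := fun i : Fin k ↦ η i T)
      fun i ↦ (hηmem i T).1
    simpa only [hηcov] using h
  have hmem := BoxModel.tendsto_memory (q := q) hd
  refine ⟨hdq, fun h1 t ω ↦ BoxModel.eq_temperature hΦ.isUnit h1 X t ω, hthermal,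
    ⟨BoxModel.isGaussianProcess_of_inClosedSpan hW fun p ↦ hRmem p.1 p.2,
      fun p ↦ hRmean p.1 p.2, fun p p' ↦ hRcov p.1 p'.1 p.2 p'.2⟩,
    ⟨η, fun i t ↦ ⟨_, (BoxModel.isWienerIntegral_ornstein hB' hc hm (hd i) t).congr hBB',
      ae_of_all _ fun ω ↦ rfl⟩, hsol, ?_, hGPη, ?_⟩,
    fun i j t t' h ↦ BoxModel.etaCov_of_le hd i j h, fun i j t t' h ↦ BoxModel.etaCov_of_ge hd i j h,
    BoxModel.isEquivalent_etaCov_gammaCross hd, BoxModel.gammaCross_self, hGPS, ?_, hGPT,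
    BoxModel.sum_gammaCross hd hq, ?_⟩
  -- Path integration is not measurable for the product σ-algebra on path space, so independence
  -- cannot be inherited from `h_indep` by composition. It follows from zero cross-covariances, as
  -- `R` and `η` together lie in the closed span of one Gaussian process.
  · refine IsGaussianProcess.indepFun_of_covariance_eq_zero
      (X := fun p : Fin k × ℝ≥0 ↦ R p.1 p.2) (Y := fun p : Fin k × ℝ≥0 ↦ η p.1 p.2)
      (BoxModel.isGaussianProcess_of_inClosedSpan (hW := hW2) hW ?_)
      (fun p ↦ (hRmem p.1 p.2).1.aestronglyMeasurable.aemeasurable)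
      (fun p ↦ (hηmem p.1 p.2).1.aestronglyMeasurable.aemeasurable)
      fun p p' ↦ hRη p.1 p'.1 p.2 p'.2
    rintro (p | p)
    · exact hRmem p.1 p.2
    · exact hηmem p.1 p.2
  · exact BoxModel.isLongTimeGP_of_isGP hGPη
      (fun n i t ↦ BoxModel.posSemidef_memory hd hPSD i t) hmem
      fun i j t t' ↦ BoxModel.gammaCross_eq_etaCov_add hd i j t t'
  · refine BoxModel.isLongTimeGP_of_isGP hGPS
      (R := fun i j t t' ↦ σ ^ 2 * BoxModel.memory d q i j t t')
      (c₀ := fun i j t t' ↦ BoxModel.kCross d q K i j t t' + σ ^ 2 * BoxModel.etaCov d q i j t t')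
      (fun n i t ↦ ?_) (fun i j ↦ ?_) fun i j t t' ↦ ?_
    · exact (BoxModel.posSemidef_memory hd hPSD i t).smul (sq_nonneg σ)
    · simpa using (hmem i j).const_mul (σ ^ 2)
    · rw [BoxModel.gammaCross_eq_etaCov_add hd]
      ring
  · refine BoxModel.isLongTimeGP_of_isGP (hGPT.comp (Prod.snd : Unit × ℝ≥0 → ℝ≥0))
      (R := fun _ _ t t' ↦ σ ^ 2 * ∑ i, ∑ j, BoxModel.memory d q i j t t')
      (c₀ := fun _ _ t t' ↦ (∑ i, ∑ j, BoxModel.kCross d q K i j t t') +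
        σ ^ 2 * ∑ i, ∑ j, BoxModel.etaCov d q i j t t')
      (fun n i t ↦ ?_) (fun _ _ ↦ ?_) fun _ _ t t' ↦ ?_
    · exact (BoxModel.posSemidef_sum_memory hd hPSD t).smul (sq_nonneg σ)
    · simpa using (tendsto_finsetSum (Finset.univ : Finset (Fin k)) fun i _ ↦
        tendsto_finsetSum (Finset.univ : Finset (Fin k)) fun j _ ↦ hmem i j).const_mul (σ ^ 2)
    -- The weights `ν i` are traded back for the double sum of `gammaCross`, which splits termwise
    -- into `etaCov` and `memory`.
    · rw [← BoxModel.sum_gammaCross hd hq]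
      simp_rw [BoxModel.gammaCross_eq_etaCov_add hd, Finset.sum_add_distrib]
      ring
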